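/- **Setting.** Let $\{\varphi_{J_0k}:0\le k<2^{J_0}\}\cup\{\psi_{lk}: l\ge J_0,\ 0\le k<2^l\}$ be an orthonormal wavelet basis of $L^2([0,1])$, either periodized or boundary corrected, constructed from a scaling function and a corresponding wavelet $\phi,\psi$ on $\mathbb R$ with $\sup_x\sum_k|\phi(x-k)|<\infty$, $\sup_x\sum_k|\psi(x-k)|<\infty$ (no smoothness of the wavelets is needed). Write $\Lambda$ for the index set, where the scaling functions are given the level $l=\max(J_0-1,0)$, and $f_{lk}$ for the coefficients of $f\in L^2([0,1])$. One observes $Y^{(n)}_\lambda=f_\lambda+n^{-1/2}Z_\lambda$, $\lambda\in\Lambda$, with $Z_\lambda$ i.i.d. $N(0,1)$; $\mathbb P_0,\mathbb E_0$ refer to the true $f=f_0$, and $\mathbb Y=\mathbb Y^{(n)}$ is the sequence $(Y^{(n)}_\lambda)_\lambda$. A weighting sequence is a nondecreasing $w=(w_l)_{l\ge 0}$ with $w_l\ge1$; it is *admissible* if $w_l/\sqrt l$ is nondecreasing in $l\ge1$ and tends to $\infty$. Put $\|x\|_{\mathcal M(w)}=\sup_l w_l^{-1}\max_k|x_{lk}|$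 and let $\mathcal M_0(w)$ be the space of $x$ with $w_l^{-1}\max_k|x_{lk}|\to0$, with this norm. Let $\mathcal H(\beta,R)$ be the set of $f$ with $|f_{lk}|\le R2^{-l(\beta+1/2)}$ for all $(l,k)\in\Lambda$ and, for a fixed positive integer $j_1$, let $\mathcal H_{SS}(\beta,R,\varepsilon)$ be the set of $f\in\mathcal H(\beta,R)$ with $\|K_j(f)-f\|_\infty\ge\varepsilon2^{-j\beta}$ for all $j\ge\max(j_1,J_0)$, where $K_j(f)=\sum_k\langle f,\varphi_{jk}\rangle\varphi_{jk}$ is the wavelet projection at resolution level $j$. Let $\Pi'=\Pi'_n$ be the slab and spike prior with $j_0(n)\equiv0$: with $J_n=\lfloor\log n/\log2\rfloor$ the coefficients $f_{jk}$ are independent; at level $0$ they have density $g$; at levels $0<j\le J_n$ they have law $(1-w_{j,n})\delta_0+w_{j,n}\,g(x)dx$; at levels $j>J_n$ they are $0$. Here $g$ is a bounded, strictly positive probability density on $\mathbb R$ and $n^{-K}\le w_{j,n}\le2^{-j(1+\tau)}$ for some $K>0$, $\tau>1/2$. Let $\Pi'(\cdot\mid Y^{(n)})$ be the posterior. **Proposition.**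 For any $\beta,R>0$ there is $\varepsilon>0$, depending only on $\beta$, $R$ and the wavelet basis, such that for every admissible $w$, every such prior $\Pi'$ and every positive integer $j_1$ there is $f_0\in\mathcal H_{SS}(\beta,R,\varepsilon)$ for which: 1. there are a strictly increasing sequence $(n_m)$ of natural numbers and a sequence $\bar M_n\to\infty$ such that, for every $M_n\to\infty$ with $M_n\le\bar M_n$ for all large $n$, $$\mathbb E_0\,\Pi'\bigl(\|f-\mathbb Y\|_{\mathcal M(w)}\ge M_{n_m}n_m^{-1/2}\,\big|\,Y^{(n_m)}\bigr)\to1\qquad(m\to\infty);$$ 2. the weak Bernstein–von Mises phenomenon in $\mathcal M_0(w)$ fails at $f_0$: it is not the case that $\mathbb E_0\,\beta_{\mathcal M_0(w)}\bigl(\mathcal L(\sqrt n(f-\mathbb Y)\mid Y^{(n)}),\mathcal N\bigr)\to0$ as $n\to\infty$, where $\mathcal L(\,\cdot\mid Y^{(n)})$ denotes the law under the posterior of $\Pi'$, $\mathcal N$ is the law of $(Z_\lambda)_\lambda$ on $\mathcal M_0(w)$, and $\beta_S(\mu,\nu)=\sup\{|\int u\,d(\mu-\nu)|:\sup|u|+\mathrm{Lip}(u)\le1\}$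 is the bounded Lipschitz metric. -/

import Mathlib

open MeasureTheory ProbabilityTheory Filter Topology
open scoped ENNReal NNReal

namespace SlabSpikeBvM

noncomputable section

/-! ### Wavelet bases of `L²([0,1])` -/

/-- `h_{jk}(x) = 2^{j/2} h(2^j x - k)`. -/
def dil (h : ℝ → ℝ) (j : ℕ) (k : ℤ) (x : ℝ) : ℝ :=
  (2 : ℝ) ^ ((j : ℝ) / 2) * h ((2 : ℝ) ^ j * x - k)

/-- The subspace of `L²(μ)` spanned (algebraically) by the classes of a family of functions. -/
def spanL2 {ι : Type*} (μ : Measure ℝ) (F : ι → ℝ → ℝ) : Submodule ℝ (Lp ℝ 2 μ) :=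
  Submodule.span ℝ {u : Lp ℝ 2 μ | ∃ i, u =ᵐ[μ] F i}

/-- `φ` is a scaling function of `L²(ℝ)` and `ψ` a corresponding wavelet (orthonormal
multiresolution analysis), with the localization property
`sup_x ∑_k |φ(x-k)| < ∞`, `sup_x ∑_k |ψ(x-k)| < ∞`. -/
structure IsScalingWaveletPair (φ ψ : ℝ → ℝ) : Prop where
  memLp_φ : MemLp φ 2 volume
  memLp_ψ : MemLp ψ 2 volume
  orth_φ : ∀ k l : ℤ, ∫ x : ℝ, φ (x - k) * φ (x - l) = if k = l then 1 else 0
  orth_ψ : ∀ k l : ℤ, ∫ x : ℝ, ψ (x - k) * ψ (x - l) = if k = l then 1 else 0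
  orth_φψ : ∀ k l : ℤ, ∫ x : ℝ, φ (x - k) * ψ (x - l) = 0
  /-- `V_1 = V_0 ⊕ W_0` -/
  refine_eq : (spanL2 volume (dil φ 1)).topologicalClosure =
    (spanL2 volume (dil φ 0)).topologicalClosure ⊔ (spanL2 volume (dil ψ 0)).topologicalClosure
  /-- `⋃_j V_j` is dense in `L²(ℝ)` -/
  dense : (⨆ j : ℕ, spanL2 volume (dil φ j)).topologicalClosure = ⊤
  local_φ : ∃ C : ℝ, ∀ x : ℝ, Summable (fun k : ℤ => |φ (x - k)|) ∧ ∑' k : ℤ, |φ (x - k)| ≤ C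
  local_ψ : ∃ C : ℝ, ∀ x : ℝ, Summable (fun k : ℤ => |ψ (x - k)|) ∧ ∑' k : ℤ, |ψ (x - k)| ≤ C

/-- The family `(h^I_{jk})`, `j ≥ J0`, `0 ≤ k < 2^j`, consists on `[0,1]` of the periodizations
`∑_{m ∈ ℤ} h_{jk}(x+m)`. -/
def IsPeriodization (J0 : ℕ) (h : ℝ → ℝ) (hI : ℕ → ℕ → ℝ → ℝ) : Prop :=
  ∀ j, J0 ≤ j → ∀ k < 2 ^ j, ∀ x ∈ Set.Icc (0 : ℝ) 1, hI j k x = ∑' m : ℤ, dil h j k (x + m)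

/-- The family `(h^I_{jk})`, `j ≥ J0`, `0 ≤ k < 2^j`, consists on `[0,1]` of `N` left edge functions,
`N` right edge functions (dilates about `0`, respectively about `1`, of fixed bounded functions of
compact support) and `2^j - 2N` interior functions, which are the usual dilates and translates of
`h` and vanish outside `[0,1]`. -/
def IsBoundaryCorrection (J0 N : ℕ) (h : ℝ → ℝ) (hI : ℕ → ℕ → ℝ → ℝ) : Prop :=
  2 * N ≤ 2 ^ J0 ∧ HasCompactSupport h ∧ (∃ C : ℝ, ∀ x, |h x| ≤ C) ∧
  (∀ j, J0 ≤ j → ∀ k, N ≤ k → k + N < 2 ^ j → Function.support (dil h j k) ⊆ Set.Icc 0 1) ∧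
  ∃ left right : ℕ → ℝ → ℝ,
    (∀ k < N, HasCompactSupport (left k) ∧ ∃ C : ℝ, ∀ x, |left k x| ≤ C) ∧
    (∀ k < N, HasCompactSupport (right k) ∧ ∃ C : ℝ, ∀ x, |right k x| ≤ C) ∧
    ∀ j, J0 ≤ j → ∀ k < 2 ^ j, ∀ x ∈ Set.Icc (0 : ℝ) 1, hI j k x =
      if k < N then dil (left k) j 0 x
      else if k + N < 2 ^ j then dil h j k x
      else dil (right (2 ^ j - 1 - k)) j 0 (x - 1)

/-- Lebesgue measure on `[0,1]`. -/
def μI : Measure ℝ := volume.restrict (Set.Icc 0 1)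

/-- An orthonormal wavelet basis of `L²([0,1])` with scaling functions `φ_{jk}` and wavelets
`ψ_{jk}`, `j ≥ J0`, `0 ≤ k < 2^j`, that is either periodized or boundary corrected. No smoothness
of the wavelets is required. -/
structure WaveletBasis where
  J0 : ℕ
  /-- the scaling function and the wavelet on the line -/
  father : ℝ → ℝ
  mother : ℝ → ℝ
  isPair : IsScalingWaveletPair father mother
  φ : ℕ → ℕ → ℝ → ℝ
  ψ : ℕ → ℕ → ℝ → ℝ
  form : (IsPeriodization J0 father φ ∧ IsPeriodization J0 mother ψ) ∨
    ∃ N, IsBoundaryCorrection J0 N father φ ∧ IsBoundaryCorrection J0 N mother ψ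
  memLp_φ : ∀ j, J0 ≤ j → ∀ k < 2 ^ j, MemLp (φ j k) 2 μI
  memLp_ψ : ∀ j, J0 ≤ j → ∀ k < 2 ^ j, MemLp (ψ j k) 2 μI
  orth_φ : ∀ j, J0 ≤ j → ∀ k < 2 ^ j, ∀ l < 2 ^ j,
    ∫ x, φ j k x * φ j l x ∂μI = if k = l then 1 else 0
  orth_ψ : ∀ j, J0 ≤ j → ∀ k < 2 ^ j, ∀ l < 2 ^ j,
    ∫ x, ψ j k x * ψ j l x ∂μI = if k = l then 1 else 0
  orth_φψ : ∀ j, J0 ≤ j → ∀ k < 2 ^ j, ∀ l < 2 ^ j, ∫ x, φ j k x * ψ j l x ∂μI = 0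
  /-- `V_{j+1} = V_j ⊕ W_j` -/
  refine_eq : ∀ j, J0 ≤ j →
    spanL2 μI (fun k : Fin (2 ^ (j + 1)) => φ (j + 1) k) =
      spanL2 μI (fun k : Fin (2 ^ j) => φ j k) ⊔ spanL2 μI (fun k : Fin (2 ^ j) => ψ j k)
  /-- `⋃_j V_j` is dense in `L²([0,1])` -/
  dense : (⨆ i : ℕ, spanL2 μI (fun k : Fin (2 ^ (J0 + i)) => φ (J0 + i) k)).topologicalClosure = ⊤

/-! ### Multiscale sequences -/

/-- The index set of the basis `{φ_{J0 k}} ∪ {ψ_{lk} : l ≥ J0}`: `Sum.inl k` stands for `φ_{J0 k}`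
and `Sum.inr ⟨i, k⟩` for `ψ_{J0+i, k}`. -/
abbrev Idx (J0 : ℕ) : Type := Fin (2 ^ J0) ⊕ (Σ i : ℕ, Fin (2 ^ (J0 + i)))

/-- The resolution level of an index. The scaling functions count as wavelets of the level just
below `J0` (of level `0` if `J0 = 0`). -/
def level {J0 : ℕ} : Idx J0 → ℕ
  | Sum.inl _ => J0 - 1
  | Sum.inr p => J0 + p.1

/-- A weighting sequence: monotone increasing with `w_l ≥ 1`. -/
structure Weight where
  w : ℕ → ℝ
  mono : Monotone w
  one_le : ∀ l, 1 ≤ w l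

/-- `w_l / √l ↗ ∞`. -/
def Weight.Admissible (w : Weight) : Prop :=
  MonotoneOn (fun l : ℕ => w.w l / √(l : ℝ)) (Set.Ici 1) ∧
    Tendsto (fun l : ℕ => w.w l / √(l : ℝ)) atTop atTop

/-- `‖x‖_{𝓜(w)} = sup_l w_l⁻¹ max_k |x_{lk}| ∈ [0,∞]`. -/
def mNorm {J0 : ℕ} (w : Weight) (x : Idx J0 → ℝ) : ℝ≥0∞ :=
  ⨆ i : Idx J0, ENNReal.ofReal (|x i| / w.w (level i))

/-- `𝓜₀(w)`: the sequences with `w_l⁻¹ max_k |x_{lk}| → 0` as `l → ∞`. -/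
@[ext] structure MZero (J0 : ℕ) (w : Weight) where
  val : Idx J0 → ℝ
  vanish : ∀ δ > 0, ∃ L : ℕ, ∀ i, L ≤ level i → |val i| / w.w (level i) ≤ δ

theorem finite_level_lt (J0 L : ℕ) : {i : Idx J0 | level i < L}.Finite := by
  have h : {i : Idx J0 | level i < L} ⊆ Set.range (Sum.inl : Fin (2 ^ J0) → Idx J0) ∪
      ⋃ a ∈ Finset.range L, Set.range (fun k : Fin (2 ^ (J0 + a)) => (Sum.inr ⟨a, k⟩ : Idx J0)) := by
    rintro (k | ⟨a, k⟩) hi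
    · exact Or.inl ⟨k, rfl⟩
    · refine Or.inr ?_
      simp only [level, Set.mem_ofPred_eq] at hi
      simp only [Set.mem_iUnion]
      exact ⟨a, Finset.mem_range.2 (by omega), k, rfl⟩
  refine Set.Finite.subset (Set.Finite.union (Set.finite_range _) ?_) h
  exact Set.Finite.biUnion (Finset.finite_toSet _) fun a _ => Set.finite_range _

theorem Weight.pos (w : Weight) (l : ℕ) : 0 < w.w l := one_pos.trans_le (w.one_le l)

theorem mNorm_le_iff {J0 : ℕ} (w : Weight) (x : Idx J0 → ℝ) {r : ℝ} (hr : 0 ≤ r) :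
    mNorm w x ≤ ENNReal.ofReal r ↔ ∀ i, |x i| / w.w (level i) ≤ r := by
  simp only [mNorm, iSup_le_iff, ENNReal.ofReal_le_ofReal_iff hr]

theorem mNorm_sub_ne_top {J0 : ℕ} {w : Weight} (x y : MZero J0 w) :
    mNorm w (x.val - y.val) ≠ ∞ := by
  obtain ⟨L, hL⟩ := x.vanish 1 one_pos
  obtain ⟨L', hL'⟩ := y.vanish 1 one_pos
  obtain ⟨C, hC⟩ := ((finite_level_lt J0 (max L L')).image
    (fun i => |x.val i - y.val i| / w.w (level i))).bddAbove
  have : mNorm w (x.val - y.val) ≤ ENNReal.ofReal (max C 2) := by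
    rw [mNorm_le_iff _ _ (le_max_of_le_right (by norm_num))]
    intro i
    by_cases hi : level i < max L L'
    · exact le_max_of_le_left (hC ⟨i, hi, rfl⟩)
    · push Not at hi
      refine le_max_of_le_right ?_
      have h1 := hL i (le_of_max_le_left hi)
      have h2 := hL' i (le_of_max_le_right hi)
      have h3 : |x.val i - y.val i| / w.w (level i)
          ≤ |x.val i| / w.w (level i) + |y.val i| / w.w (level i) := by
        rw [← add_div]
        exact div_le_div_of_nonneg_right (abs_sub _ _) (w.pos _).le
      simp only [Pi.sub_apply]
      linarith
  exact ne_top_of_le_ne_top ENNReal.ofReal_ne_top this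

theorem toReal_mNorm_le_iff {J0 : ℕ} {w : Weight} (x y : MZero J0 w) {r : ℝ} (hr : 0 ≤ r) :
    (mNorm w (x.val - y.val)).toReal ≤ r ↔ ∀ i, |x.val i - y.val i| / w.w (level i) ≤ r := by
  rw [← ENNReal.le_ofReal_iff_toReal_le (mNorm_sub_ne_top x y) hr, mNorm_le_iff _ _ hr]
  rfl

/-- `𝓜₀(w)` with the distance `‖x - y‖_{𝓜(w)}`. -/
instance {J0 : ℕ} {w : Weight} : MetricSpace (MZero J0 w) where
  dist x y := (mNorm w (x.val - y.val)).toReal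
  dist_self x := by simp [mNorm]
  dist_comm x y := by simp [mNorm, abs_sub_comm]
  dist_triangle x y z := by
    rw [toReal_mNorm_le_iff _ _ (by positivity)]
    intro i
    have h1 := (toReal_mNorm_le_iff x y ENNReal.toReal_nonneg).1 le_rfl i
    have h2 := (toReal_mNorm_le_iff y z ENNReal.toReal_nonneg).1 le_rfl i
    refine le_trans ?_ (add_le_add h1 h2)
    rw [← add_div]
    exact div_le_div_of_nonneg_right (abs_sub_le _ _ _) (w.pos _).le
  eq_of_dist_eq_zero := by
    intro x y h
    apply MZero.ext
    funext i
    have h1 := (toReal_mNorm_le_iff x y le_rfl).1 (le_of_eq h) i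
    rw [div_le_iff₀ (w.pos _), zero_mul] at h1
    exact sub_eq_zero.1 (abs_eq_zero.1 (le_antisymm h1 (abs_nonneg _)))

theorem MZero.dist_le_iff {J0 : ℕ} {w : Weight} (x y : MZero J0 w) {r : ℝ} (hr : 0 ≤ r) :
    dist x y ≤ r ↔ ∀ i, |x.val i - y.val i| / w.w (level i) ≤ r := toReal_mNorm_le_iff x y hr

/-- The trace of the product σ-algebra; it is the Borel σ-algebra of `𝓜₀(w)`, see below. -/
instance {J0 : ℕ} {w : Weight} : MeasurableSpace (MZero J0 w) :=
  MeasurableSpace.comap MZero.val inferInstance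

instance {J0 : ℕ} {w : Weight} : TopologicalSpace.SeparableSpace (MZero J0 w) := by
  have hmem : ∀ q : Idx J0 →₀ ℚ, ∀ δ > (0 : ℝ), ∃ L : ℕ, ∀ i, L ≤ level i →
      |((q i : ℚ) : ℝ)| / w.w (level i) ≤ δ := by
    intro q δ hδ
    refine ⟨q.support.sup level + 1, fun i hi => ?_⟩
    have : i ∉ q.support := fun h => by
      have := Finset.le_sup (f := level) h
      omega
    rw [Finsupp.notMem_support_iff] at this
    simpa [this] using hδ.le
  refine ⟨⟨Set.range fun q : Idx J0 →₀ ℚ => (⟨fun i => ((q i : ℚ) : ℝ), hmem q⟩ : MZero J0 w),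
    Set.countable_range _, ?_⟩⟩
  rw [Metric.dense_iff]
  intro x r hr
  obtain ⟨L, hL⟩ := x.vanish (r / 2) (by positivity)
  choose q hq using fun i => exists_rat_near (x.val i) (show 0 < r / 2 by positivity)
  classical
  let p : Idx J0 →₀ ℚ := Finsupp.onFinset (finite_level_lt J0 L).toFinset
    (fun i => if level i < L then q i else 0) (by
      intro i hi
      simp only [ne_eq, ite_eq_right_iff, Classical.not_imp] at hi
      simpa using hi.1)
  refine ⟨_, ?_, ⟨p, rfl⟩⟩
  rw [Metric.mem_ball, dist_comm]
  refine lt_of_le_of_lt ((MZero.dist_le_iff _ _ (show 0 ≤ r / 2 by positivity)).2 fun i => ?_)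
    (half_lt_self hr)
  by_cases hi : level i < L
  · simp only [p, Finsupp.onFinset_apply, hi, if_true]
    rw [div_le_iff₀ (w.pos _)]
    have := w.one_le (level i)
    nlinarith [hq i]
  · simp only [p, Finsupp.onFinset_apply, hi, if_false, Rat.cast_zero, sub_zero]
    exact hL i (not_lt.1 hi)

instance {J0 : ℕ} {w : Weight} : BorelSpace (MZero J0 w) := by
  constructor
  apply le_antisymm
  · have hc : ∀ i, Continuous fun x : MZero J0 w => x.val i := by
      intro i
      refine (LipschitzWith.of_dist_le_mul (K := ⟨w.w (level i), (w.pos _).le⟩) fun x y => ?_).continuous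
      have := (MZero.dist_le_iff x y dist_nonneg).1 le_rfl i
      rw [div_le_iff₀ (w.pos _)] at this
      rw [Real.dist_eq]
      exact this.trans_eq (mul_comm _ _)
    have : @Measurable _ _ (borel (MZero J0 w)) _ (MZero.val : MZero J0 w → Idx J0 → ℝ) := by
      let _ : MeasurableSpace (MZero J0 w) := borel _
      have _ : BorelSpace (MZero J0 w) := ⟨rfl⟩
      exact measurable_pi_iff.2 fun i => (hc i).measurable
    exact this.comap_le
  · have hball : ∀ (c : MZero J0 w) (r : ℝ), 0 ≤ r → MeasurableSet (Metric.closedBall c r) := by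
      intro c r hr
      have : Metric.closedBall c r = ⋂ i, {x : MZero J0 w | |x.val i - c.val i| / w.w (level i) ≤ r} := by
        ext x
        simp only [Metric.mem_closedBall, MZero.dist_le_iff x c hr, Set.mem_iInter, Set.mem_ofPred_eq]
      rw [this]
      refine MeasurableSet.iInter fun i => ?_
      have hm : Measurable fun x : MZero J0 w => x.val i :=
        (measurable_pi_apply i).comp (comap_measurable _)
      exact measurableSet_le (((hm.sub_const _).abs).div_const _) measurable_const
    refine MeasurableSpace.generateFrom_le fun U hU => ?_
    obtain ⟨D, hDc, hDd⟩ := TopologicalSpace.exists_countable_dense (MZero J0 w)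
    have hU' : U = ⋃ d ∈ D, ⋃ q : {q : ℚ // (0 : ℝ) ≤ q ∧ Metric.closedBall d (q : ℝ) ⊆ U},
        Metric.closedBall d ((q : ℚ) : ℝ) := by
      ext x
      simp only [Set.mem_iUnion]
      constructor
      · intro hx
        obtain ⟨r, hr, hrU⟩ := Metric.isOpen_iff.1 (show IsOpen U from hU) x hx
        obtain ⟨q, hq0, hqr⟩ := exists_rat_btwn (show (0 : ℝ) < r / 2 by positivity)
        obtain ⟨d, hd, hdD⟩ := Metric.dense_iff.1 hDd x q hq0
        rw [Metric.mem_ball] at hd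
        refine ⟨d, hdD, ⟨q, hq0.le, fun y hy => hrU ?_⟩, ?_⟩
        · rw [Metric.mem_closedBall] at hy
          rw [Metric.mem_ball]
          linarith [dist_triangle y d x]
        · rw [Metric.mem_closedBall, dist_comm]
          exact hd.le
      · rintro ⟨d, _, q, hq⟩
        exact q.2.2 hq
    rw [hU']
    exact MeasurableSet.biUnion hDc fun d _ => MeasurableSet.iUnion fun q => hball d _ q.2.1

/-! ### Functions on `[0,1]`, Hölder balls and self-similarity -/

/-- The basis function with a given index. -/
def WaveletBasis.e (B : WaveletBasis) : Idx B.J0 → ℝ → ℝ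
  | Sum.inl k => B.φ B.J0 k
  | Sum.inr p => B.ψ (B.J0 + p.1) p.2

/-- The wavelet coefficients of `f`. -/
def WaveletBasis.coeff (B : WaveletBasis) (f : ℝ → ℝ) (i : Idx B.J0) : ℝ :=
  ∫ x, f x * B.e i x ∂μI

/-- `K_j(f) = ∑_k ⟨f, φ_{jk}⟩ φ_{jk}`. -/
def WaveletBasis.K (B : WaveletBasis) (j : ℕ) (f : ℝ → ℝ) (x : ℝ) : ℝ :=
  ∑ k ∈ Finset.range (2 ^ j), (∫ y, f y * B.φ j k y ∂μI) * B.φ j k x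

/-- The ball `𝓗(β,R)`: functions with `|f_{lk}| ≤ R 2^{-l(β+1/2)}` for all `(l,k)`. -/
def WaveletBasis.holderBall (B : WaveletBasis) (β R : ℝ) : Set (ℝ → ℝ) :=
  {f | MemLp f 2 μI ∧ ∀ i, |B.coeff f i| ≤ R * (2 : ℝ) ^ (-(level i : ℝ) * (β + 1 / 2))}

/-- The self-similar class `𝓗_SS(β,R,ε)`: those `f ∈ 𝓗(β,R)` with
`‖K_j(f) - f‖_∞ ≥ ε 2^{-jβ}` for all `j ≥ j₁` (and `j ≥ J0`, so that `K_j` is defined). -/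
def WaveletBasis.selfSimilar (B : WaveletBasis) (j₁ : ℕ) (β R ε : ℝ) : Set (ℝ → ℝ) :=
  {f | f ∈ B.holderBall β R ∧ ∀ j, j₁ ≤ j → B.J0 ≤ j →
    ENNReal.ofReal (ε * (2 : ℝ) ^ (-(j : ℝ) * β)) ≤ eLpNorm (fun x => B.K j f x - f x) ∞ μI}

/-! ### White noise model, prior and posterior -/

/-- The law `P_{f}` of `Y_λ = f_λ + n^{-1/2} Z_λ`, with `Z_λ` i.i.d. standard normal. -/
def dataLaw {J0 : ℕ} (n : ℕ) (f : Idx J0 → ℝ) : Measure (Idx J0 → ℝ) :=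
  Measure.infinitePi fun i => gaussianReal (f i) (n : ℝ≥0)⁻¹

/-- The law of the white noise `(Z_λ)`. -/
def whiteNoise (J0 : ℕ) : Measure (Idx J0 → ℝ) :=
  Measure.infinitePi fun _ => gaussianReal 0 1

/-- The likelihood `dP_f/dP_0 (Y) = exp(n ∑ Y_λ f_λ - n ∑ f_λ² / 2)`, for `f` with finitely many
nonzero coefficients. -/
def likelihood {J0 : ℕ} (n : ℕ) (Y f : Idx J0 → ℝ) : ℝ≥0∞ :=
  ENNReal.ofReal (Real.exp (∑' i, ((n : ℝ) * (Y i * f i) - (n : ℝ) * f i ^ 2 / 2)))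

/-- The posterior `Π(· | Y^{(n)})` by Bayes' formula, for a prior under which almost every `f` has
finitely many nonzero coefficients. -/
def posterior {J0 : ℕ} (prior : Measure (Idx J0 → ℝ)) (n : ℕ) (Y : Idx J0 → ℝ) :
    Measure (Idx J0 → ℝ) :=
  (∫⁻ f, likelihood n Y f ∂prior)⁻¹ • prior.withDensity (likelihood n Y)

/-- The parameters of a slab and spike prior with lower threshold `j0 (n)`: the slab density `g`,
bounded and strictly positive, and the mixing weights `w_{jn}` with
`n^{-K} ≤ w_{jn} ≤ 2^{-j(1+τ)}` for `j0 (n) < j ≤ J_n`, where `J_n = ⌊log n / log 2⌋`. -/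
structure SlabSpike (j0 : ℕ → ℕ) where
  g : ℝ → ℝ
  measurable_g : Measurable g
  pos_g : ∀ x, 0 < g x
  bdd_g : ∃ C : ℝ, ∀ x, g x ≤ C
  lintegral_g : ∫⁻ x, ENNReal.ofReal (g x) = 1
  wt : ℕ → ℕ → ℝ
  K : ℝ
  τ : ℝ
  pos_K : 0 < K
  half_lt_τ : 1 / 2 < τ
  lower : ∀ n j, j0 n < j → j ≤ Nat.log 2 n → (n : ℝ) ^ (-K) ≤ wt j n
  upper : ∀ n j, j0 n < j → j ≤ Nat.log 2 n → wt j n ≤ (2 : ℝ) ^ (-(j : ℝ) * (1 + τ))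

/-- The slab `g(x) dx`. -/
def SlabSpike.slab {j0 : ℕ → ℕ} (P : SlabSpike j0) : Measure ℝ :=
  volume.withDensity fun x => ENNReal.ofReal (P.g x)

/-- The prior law of a coefficient at level `j`. -/
def SlabSpike.marginal {j0 : ℕ → ℕ} (P : SlabSpike j0) (n j : ℕ) : Measure ℝ :=
  if j ≤ j0 n then P.slab
  else if j ≤ Nat.log 2 n then
    ENNReal.ofReal (1 - P.wt j n) • Measure.dirac 0 + ENNReal.ofReal (P.wt j n) • P.slab
  else Measure.dirac 0

/-- The product prior on coefficient sequences. -/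
def SlabSpike.prior {j0 : ℕ → ℕ} (P : SlabSpike j0) (J0 n : ℕ) : Measure (Idx J0 → ℝ) :=
  Measure.infinitePi fun i => P.marginal n (level i)

/-! ### Weak Bernstein–von Mises -/

/-- `‖u‖_BL = sup |u| + Lip(u) ≤ 1`. -/
def BLUnit {S : Type*} [PseudoMetricSpace S] (u : S → ℝ) : Prop :=
  ∃ a b : ℝ, a + b ≤ 1 ∧ 0 ≤ a ∧ 0 ≤ b ∧ (∀ s, |u s| ≤ a) ∧ ∀ s t, |u s - u t| ≤ b * dist s t

/-- The bounded Lipschitz metric. -/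
def blDist {S : Type*} [PseudoMetricSpace S] [MeasurableSpace S] (μ ν : Measure S) : ℝ≥0∞ :=
  ⨆ (u : S → ℝ) (_ : BLUnit u), ENNReal.ofReal |∫ s, u s ∂μ - ∫ s, u s ∂ν|

/-- A measure on sequences that is concentrated on `𝓜₀(w)`, as a measure on `𝓜₀(w)`. -/
def onMZero {J0 : ℕ} (w : Weight) (μ : Measure (Idx J0 → ℝ)) : Measure (MZero J0 w) :=
  μ.comap MZero.val

/-- The law of `√n (f - Y)` under the posterior. -/
def scaledPosterior {J0 : ℕ} (prior : Measure (Idx J0 → ℝ)) (n : ℕ) (Y : Idx J0 → ℝ) :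
    Measure (Idx J0 → ℝ) :=
  (posterior prior n Y).map fun f i => √(n : ℝ) * (f i - Y i)

/-- The weak Bernstein–von Mises phenomenon in `𝓜₀(w)` at `f0`:
`E_0 β(Π_n ∘ τ_Y⁻¹, 𝓝) → 0`. -/
def WeakBvM {J0 : ℕ} (w : Weight) (prior : ℕ → Measure (Idx J0 → ℝ)) (f0 : Idx J0 → ℝ) : Prop :=
  Tendsto (fun n : ℕ => ∫⁻ Y, blDist (onMZero w (scaledPosterior (prior n) n Y))
    (onMZero w (whiteNoise J0)) ∂dataLaw n f0) atTop (𝓝 0)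

/-- `E_0 Π(‖f - Y‖_{𝓜(w)} ≥ M n^{-1/2} | Y^{(n)})`. -/
def expectedOutside {J0 : ℕ} (w : Weight) (prior : Measure (Idx J0 → ℝ)) (n : ℕ) (M : ℝ)
    (f0 : Idx J0 → ℝ) : ℝ≥0∞ :=
  ∫⁻ Y, posterior prior n Y
    {f | ENNReal.ofReal (M / √(n : ℝ)) ≤ mNorm w (fun i => f i - Y i)} ∂dataLaw n f0

end

end SlabSpikeBvM

namespace SlabSpikeBvM

/-! ### The `L¹`-norm of the first wavelet of a level -/

/-! The truth carries one coefficient per level that the posterior kills although it is too large to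
be ignored. At a sparse set of levels `l = J0 + m + 1` the coefficient in position 1 equals half of
`√(log n_m / n_m)`, which is below the detection threshold at sample size `n_m`. With high
probability the observation there stays between 1/4 and 3/4 of `√(log n_m / n_m)`.

The upper bound makes the slab lose to the spike: with spike weight at least 1/2 and `g ≤ C`, the
posterior probability that the coefficient is nonzero is at most `C exp(nY²/2) √(2π/n)`, of order
`n^(9/32 - 1/2)` (`posterior_ne_zero_le_of_typical`). The lower bound then gives `√n |f - Y| = √n
|Y| ≥ √(log n)/4` at this coordinate under most of the posterior. Since `n_m` is chosen after the
level, this exceeds `(m + 1) w_l` however fast `w` grows. This is the first claim.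

For the second, a bump in that single coordinate, of width `w_l`, has almost no integral under the
rescaled posterior but an integral bounded below under white noise (`le_blDist_whiteNoise`).
Admissibility of `w` enters here only, to ensure that white noise lives on `𝓜₀(w)`.

Self-similarity is independent of all this. The coefficient in position 0 of each level is set to
its maximal value; since `K_j f - f` paired with `ψ_{j0}` returns minus that coefficient and
`‖ψ_{j0}‖₁ ≲ 2^(-j/2)`, the sup-norm lower bound follows by duality (`exists_le_eLpNorm_K_sub`),
whatever stands in position 1. -/

theorem lintegral_eq_tsum_Icc_add_intCast (F : ℝ → ℝ≥0∞) :
    ∫⁻ x, F x = ∑' m : ℤ, ∫⁻ x, F (x + m) ∂μI := by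
  rw [← setLIntegral_univ, ← iUnion_Ico_intCast ℝ,
    lintegral_iUnion (fun _ => measurableSet_Ico) (Set.pairwise_disjoint_Ico_intCast ℝ)]
  refine tsum_congr fun m => ?_
  have h := (measurePreserving_add_right (volume : Measure ℝ) (m : ℝ)).setLIntegral_comp_preimage_emb
    (measurableEmbedding_addRight (m : ℝ)) F (Set.Ico (m : ℝ) (m + 1))
  rw [← h, μI]
  have : (fun x : ℝ => x + m) ⁻¹' Set.Ico (m : ℝ) (m + 1) = Set.Ico 0 1 := by
    ext x
    simp only [Set.mem_preimage, Set.mem_Ico]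
    constructor <;> rintro ⟨h1, h2⟩ <;> constructor <;> linarith
  rw [this, setLIntegral_congr Ico_ae_eq_Icc]

theorem lintegral_comp_mul_sub (F : ℝ → ℝ≥0∞) {a : ℝ} (ha : 0 < a) (b : ℝ) :
    ∫⁻ x, F (a * x - b) = ENNReal.ofReal a⁻¹ * ∫⁻ x, F x := by
  have h := (measurableEmbedding_mulLeft₀ ha.ne').lintegral_map (μ := (volume : Measure ℝ))
    (fun y => F (y - b))
  rw [← h, Real.map_volume_mul_left ha.ne', lintegral_smul_measure, abs_of_pos (by positivity),
    lintegral_sub_right_eq_self F b, smul_eq_mul]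

theorem lintegral_enorm_dil (h : ℝ → ℝ) (j : ℕ) (k : ℤ) :
    ∫⁻ x, ‖dil h j k x‖ₑ = ENNReal.ofReal ((2 : ℝ) ^ (-(j : ℝ) / 2)) * ∫⁻ x, ‖h x‖ₑ := by
  simp only [dil, enorm_mul]
  rw [lintegral_const_mul' _ _ enorm_ne_top,
    lintegral_comp_mul_sub (fun y => ‖h y‖ₑ) (by positivity : (0 : ℝ) < 2 ^ j) k, ← mul_assoc,
    Real.enorm_eq_ofReal (by positivity), ← ENNReal.ofReal_mul (by positivity)]
  congr 2
  rw [← Real.rpow_natCast, ← Real.rpow_neg (by norm_num), ← Real.rpow_add (by norm_num)]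
  congr 1
  ring

/-- Cutting the line into unit intervals turns the integral into that of `∑ |ψ(x + m)|` over
`[0,1]`, which the localization property bounds uniformly. -/
theorem IsScalingWaveletPair.lintegral_enorm_mother_lt_top {φ ψ : ℝ → ℝ}
    (h : IsScalingWaveletPair φ ψ) : ∫⁻ x, ‖ψ x‖ₑ < ∞ := by
  obtain ⟨C, hC⟩ := h.local_ψ
  have hm : AEStronglyMeasurable ψ volume := h.memLp_ψ.1
  rw [lintegral_eq_tsum_Icc_add_intCast, ← lintegral_tsum]
  · have hle : ∀ x, ∑' m : ℤ, ‖ψ (x + m)‖ₑ ≤ ENNReal.ofReal C := by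
      intro x
      rw [← (Equiv.neg ℤ).tsum_eq]
      simp only [Equiv.neg_apply, Int.cast_neg, ← sub_eq_add_neg, Real.enorm_eq_ofReal_abs]
      rw [← ENNReal.ofReal_tsum_of_nonneg (fun _ => abs_nonneg _) (hC x).1]
      exact ENNReal.ofReal_le_ofReal (hC x).2
    refine (lintegral_mono hle).trans_lt ?_
    simp [μI]
  · intro m
    have := (hm.comp_measurePreserving (measurePreserving_add_right (volume : Measure ℝ) (m : ℝ)))
    exact this.enorm.restrict

theorem lintegral_enorm_lt_top_of_bounded {h : ℝ → ℝ} (hs : HasCompactSupport h)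
    (hb : ∃ C : ℝ, ∀ x, |h x| ≤ C) : ∫⁻ x, ‖h x‖ₑ < ∞ := by
  obtain ⟨C, hC⟩ := hb
  calc ∫⁻ x, ‖h x‖ₑ ≤ ∫⁻ x, (tsupport h).indicator (fun _ => ENNReal.ofReal C) x := by
        refine lintegral_mono fun x => ?_
        by_cases hx : x ∈ tsupport h
        · rw [Set.indicator_of_mem hx, Real.enorm_eq_ofReal_abs]
          exact ENNReal.ofReal_le_ofReal (hC x)
        · simp [image_eq_zero_of_notMem_tsupport hx]
    _ < ∞ := by
        rw [lintegral_indicator (isClosed_tsupport h).measurableSet, setLIntegral_const]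
        exact ENNReal.mul_lt_top ENNReal.ofReal_lt_top hs.isCompact.measure_lt_top

theorem lintegral_enorm_le_of_eq_dil {h u : ℝ → ℝ} {j : ℕ} {k : ℤ}
    (hu : ∀ x ∈ Set.Icc (0 : ℝ) 1, u x = dil h j k x) :
    ∫⁻ x, ‖u x‖ₑ ∂μI ≤ ∫⁻ x, ‖dil h j k x‖ₑ := by
  rw [μI, setLIntegral_congr_fun measurableSet_Icc fun x hx => by rw [hu x hx]]
  exact setLIntegral_le_lintegral _ _

theorem lintegral_enorm_periodization_le {J0 : ℕ} {h : ℝ → ℝ} {hI : ℕ → ℕ → ℝ → ℝ}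
    (H : IsPeriodization J0 h hI) (hm : AEStronglyMeasurable h volume) {j k : ℕ} (hj : J0 ≤ j)
    (hk : k < 2 ^ j) : ∫⁻ x, ‖hI j k x‖ₑ ∂μI ≤ ∫⁻ x, ‖dil h j k x‖ₑ := by
  have hd : AEStronglyMeasurable (dil h j k) volume := by
    -- `h` is only a.e. strongly measurable, so composing it with the affine map requires that null
    -- sets pull back to null sets.
    have hq : Measure.QuasiMeasurePreserving (fun x : ℝ => (2 : ℝ) ^ j * x - (k : ℤ)) := by
      refine ⟨by fun_prop, ?_⟩
      refine Measure.AbsolutelyContinuous.mk fun s hs h0 => ?_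
      rw [Measure.map_apply (by fun_prop) hs]
      have := lintegral_comp_mul_sub (s.indicator 1) (by positivity : (0 : ℝ) < 2 ^ j) (k : ℤ)
      rw [lintegral_indicator_one hs, h0, mul_zero] at this
      rw [← lintegral_indicator_one (by measurability), ← this]
      rfl
    exact (hm.comp_quasiMeasurePreserving hq).const_mul _
  rw [lintegral_eq_tsum_Icc_add_intCast (fun x => ‖dil h j k x‖ₑ), ← lintegral_tsum]
  · rw [μI, setLIntegral_congr_fun measurableSet_Icc fun x hx => by rw [H j hj k hk x hx]]
    exact lintegral_mono fun x => enorm_tsum_le_tsum_enorm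
  · intro m
    have := hd.comp_measurePreserving (measurePreserving_add_right (volume : Measure ℝ) (m : ℝ))
    exact this.enorm.restrict

/-- On `[0,1]` the functions `ψ_{j0}` are dominated in `L¹` by the dilates of one integrable
profile, and dilation scales the `L¹`-norm by `2^(-j/2)`. The profile is the mother wavelet in the
periodized case and when there are no edge functions, and otherwise the first left edge function.
One position per level suffices for self-similarity. -/
theorem WaveletBasis.exists_lintegral_enorm_ψ_le (B : WaveletBasis) :
    ∃ C : ℝ, 0 < C ∧ ∀ j, B.J0 ≤ j →
      ∫⁻ x, ‖B.ψ j 0 x‖ₑ ∂μI ≤ ENNReal.ofReal (C * (2 : ℝ) ^ (-(j : ℝ) / 2)) := by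
  suffices ∃ h : ℝ → ℝ, ∫⁻ x, ‖h x‖ₑ < ∞ ∧ ∀ j, B.J0 ≤ j →
      ∫⁻ x, ‖B.ψ j 0 x‖ₑ ∂μI ≤ ∫⁻ x, ‖dil h j 0 x‖ₑ by
    obtain ⟨h, hfin, hle⟩ := this
    refine ⟨(∫⁻ x, ‖h x‖ₑ).toReal + 1, by positivity, fun j hj => (hle j hj).trans ?_⟩
    rw [lintegral_enorm_dil, mul_comm, ENNReal.ofReal_mul (by positivity)]
    gcongr
    exact (ENNReal.ofReal_toReal hfin.ne).symm.le.trans (ENNReal.ofReal_le_ofReal (by linarith))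
  have hmother := B.isPair.lintegral_enorm_mother_lt_top
  rcases B.form with ⟨-, hψ⟩ | ⟨N, -, -, -, -, -, left, right, hleft, -, hform⟩
  · exact ⟨B.mother, hmother, fun j hj => by
      simpa using lintegral_enorm_periodization_le hψ B.isPair.memLp_ψ.1 hj
        (k := 0) (by positivity)⟩
  · rcases Nat.eq_zero_or_pos N with rfl | hN
    · refine ⟨B.mother, hmother, fun j hj => lintegral_enorm_le_of_eq_dil fun x hx => ?_⟩
      have := hform j hj 0 (by positivity) x hx
      simpa using this
    · refine ⟨left 0, lintegral_enorm_lt_top_of_bounded (hleft 0 hN).1 (hleft 0 hN).2,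
        fun j hj => lintegral_enorm_le_of_eq_dil fun x hx => ?_⟩
      have := hform j hj 0 (by positivity) x hx
      simpa [hN] using this

/-! ### Summability over the index set -/

theorem summable_of_sum_level_le {J0 : ℕ} {f : Idx J0 → ℝ} (hf : ∀ i, 0 ≤ f i)
    {r : ℕ → ℝ} (hr : Summable r) (h : ∀ i, ∑ k, f (Sum.inr ⟨i, k⟩) ≤ r i) : Summable f := by
  refine (HasSum.sum (hasSum_fintype _) (Summable.hasSum ?_)).summable
  refine (summable_sigma_of_nonneg fun _ => hf _).2 ⟨fun i => (hasSum_fintype _).summable, ?_⟩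
  refine hr.of_nonneg_of_le (fun i => tsum_nonneg fun _ => hf _) fun i => ?_
  rw [tsum_fintype]
  exact h i

/-! ### Orthonormality and synthesis -/

instance : IsFiniteMeasure μI := inferInstanceAs (IsFiniteMeasure (volume.restrict _))

theorem integral_mul_eq_zero_of_mem_spanL2 {ι : Type*} {μ : Measure ℝ} {F : ι → ℝ → ℝ} {h : ℝ → ℝ}
    (hh : MemLp h 2 μ) (hF : ∀ i, ∫ x, F i x * h x ∂μ = 0) {u : Lp ℝ 2 μ}
    (hu : u ∈ spanL2 μ F) : ∫ x, u x * h x ∂μ = 0 := by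
  have key : ∀ v : Lp ℝ 2 μ, inner ℝ (hh.toLp h) v = ∫ x, v x * h x ∂μ := by
    intro v
    rw [L2.inner_def]
    refine integral_congr_ae ?_
    filter_upwards [hh.coeFn_toLp] with x hx
    simp [hx]
  rw [← key]
  induction hu using Submodule.span_induction with
  | mem v hv =>
    obtain ⟨i, hi⟩ := hv
    rw [key, ← hF i]
    refine integral_congr_ae ?_
    filter_upwards [hi] with x hx
    rw [hx]
  | zero => simp
  | add x y _ _ hx hy => rw [inner_add_right, hx, hy, add_zero]
  | smul a x _ hx => rw [inner_smul_right, hx, mul_zero]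

namespace WaveletBasis

variable (B : WaveletBasis)

theorem spanL2_φ_mono {j j' : ℕ} (hj : B.J0 ≤ j) (hjj' : j ≤ j') :
    spanL2 μI (fun k : Fin (2 ^ j) => B.φ j k) ≤ spanL2 μI (fun k : Fin (2 ^ j') => B.φ j' k) := by
  induction j', hjj' using Nat.le_induction with
  | base => exact le_rfl
  | succ m hm ih =>
    refine ih.trans ?_
    rw [B.refine_eq m (hj.trans hm)]
    exact le_sup_left

/-- The spaces `V_j` are nested and `ψ_{j'k'}` is orthogonal to `V_{j'}`. All orthogonality between
levels follows, as `W_j ⊆ V_{j+1}`. -/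
theorem integral_ψ_mul_eq_zero {f : ℝ → ℝ} (hf : MemLp f 2 μI) {j j' k' : ℕ} (hj : B.J0 ≤ j)
    (hjj' : j ≤ j') (hk' : k' < 2 ^ j')
    (hfj : hf.toLp f ∈ spanL2 μI (fun k : Fin (2 ^ j) => B.φ j k)) :
    ∫ x, f x * B.ψ j' k' x ∂μI = 0 := by
  have hj' := hj.trans hjj'
  rw [← integral_mul_eq_zero_of_mem_spanL2 (F := fun k : Fin (2 ^ j') => B.φ j' k)
    (B.memLp_ψ j' hj' k' hk') (fun k => B.orth_φψ j' hj' k k.2 k' hk') (B.spanL2_φ_mono hj hjj' hfj)]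
  refine integral_congr_ae ?_
  filter_upwards [hf.coeFn_toLp] with x hx
  rw [hx]

theorem integral_φ_mul_ψ {j j' k k' : ℕ} (hj : B.J0 ≤ j) (hjj' : j ≤ j') (hk : k < 2 ^ j)
    (hk' : k' < 2 ^ j') : ∫ x, B.φ j k x * B.ψ j' k' x ∂μI = 0 :=
  B.integral_ψ_mul_eq_zero (B.memLp_φ j hj k hk) hj hjj' hk'
    (Submodule.subset_span ⟨⟨k, hk⟩, MemLp.coeFn_toLp _⟩)

theorem integral_ψ_mul_ψ {j j' k k' : ℕ} (hj : B.J0 ≤ j) (hjj' : j < j') (hk : k < 2 ^ j)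
    (hk' : k' < 2 ^ j') : ∫ x, B.ψ j k x * B.ψ j' k' x ∂μI = 0 := by
  refine B.integral_ψ_mul_eq_zero (B.memLp_ψ j hj k hk) (j := j + 1) (by omega) hjj' hk' ?_
  rw [B.refine_eq j hj]
  exact Submodule.mem_sup_right (Submodule.subset_span ⟨⟨k, hk⟩, MemLp.coeFn_toLp _⟩)

theorem memLp_e (i : Idx B.J0) : MemLp (B.e i) 2 μI := by
  rcases i with k | ⟨i, k⟩
  · exact B.memLp_φ _ le_rfl _ k.2
  · exact B.memLp_ψ _ (Nat.le_add_right _ _) _ k.2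

theorem integral_e_mul_e (i i' : Idx B.J0) :
    ∫ x, B.e i x * B.e i' x ∂μI = if i = i' then 1 else 0 := by
  rcases i with k | ⟨i, k⟩ <;> rcases i' with k' | ⟨i', k'⟩
  · simpa [e, Fin.ext_iff] using B.orth_φ _ le_rfl k k.2 k' k'.2
  · simpa [e] using B.integral_φ_mul_ψ le_rfl (Nat.le_add_right _ i') k.2 k'.2
  · simpa [e, mul_comm] using B.integral_φ_mul_ψ le_rfl (Nat.le_add_right _ i) k'.2 k.2
  · rcases lt_trichotomy i i' with h | rfl | h
    · have := B.integral_ψ_mul_ψ (Nat.le_add_right _ i) (Nat.add_lt_add_left h _) k.2 k'.2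
      simpa [e, h.ne] using this
    · simpa [e, Fin.ext_iff] using B.orth_ψ _ (Nat.le_add_right _ i) k k.2 k' k'.2
    · have := B.integral_ψ_mul_ψ (Nat.le_add_right _ i') (Nat.add_lt_add_left h _) k'.2 k.2
      simpa [e, h.ne', mul_comm] using this

theorem inner_toLp_e {f : ℝ → ℝ} (hf : MemLp f 2 μI) (i : Idx B.J0) :
    inner ℝ ((B.memLp_e i).toLp _) (hf.toLp f) = B.coeff f i := by
  rw [L2.inner_def]
  refine integral_congr_ae ?_
  filter_upwards [hf.coeFn_toLp, (B.memLp_e i).coeFn_toLp] with x hx hy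
  simp [hx, hy]

/-- The series `∑ c_i e_i` converges absolutely in `L²` because the `e_i` have norm one, and
continuity of the inner product reads off its coefficients. Completeness of the basis plays no role.
-/
theorem exists_coeff_eq {c : Idx B.J0 → ℝ} (hc : Summable fun i => |c i|) :
    ∃ f, MemLp f 2 μI ∧ B.coeff f = c := by
  classical
  set E : Idx B.J0 → Lp ℝ 2 μI := fun i => (B.memLp_e i).toLp _ with hE
  have hEE : ∀ i i', inner ℝ (E i) (E i') = if i' = i then (1 : ℝ) else 0 := fun i i' => by
    rw [hE, B.inner_toLp_e, coeff, B.integral_e_mul_e]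
  have hnorm : ∀ i, ‖E i‖ = 1 := fun i => by
    have := hEE i i
    rw [real_inner_self_eq_norm_sq, if_pos rfl] at this
    exact (pow_eq_one_iff_of_nonneg (norm_nonneg _) two_ne_zero).1 this
  have hs : Summable fun i => c i • E i := by
    refine Summable.of_norm (hc.congr fun i => ?_)
    rw [norm_smul, hnorm, mul_one, Real.norm_eq_abs]
  refine ⟨(∑' i, c i • E i : Lp ℝ 2 μI), Lp.memLp _, funext fun i => ?_⟩
  rw [← B.inner_toLp_e (Lp.memLp _), Lp.toLp_coeFn]
  have h1 := ((innerSL ℝ (E i)).hasSum hs.hasSum)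
  have h2 : HasSum (fun i' => innerSL ℝ (E i) (c i' • E i')) (c i) := by
    convert hasSum_ite_eq i (c i) using 2 with i'
    simp only [innerSL_apply_apply, inner_smul_right, hEE]
    split_ifs with h <;> simp [h]
  exact h1.unique h2

/-! ### Self-similarity -/

theorem integral_K_sub_mul_ψ {f : ℝ → ℝ} (hf : MemLp f 2 μI) {j k : ℕ} (hj : B.J0 ≤ j)
    (hk : k < 2 ^ j) :
    ∫ x, (B.K j f x - f x) * B.ψ j k x ∂μI = -∫ x, f x * B.ψ j k x ∂μI := by
  have hψ := B.memLp_ψ j hj k hk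
  have hint : ∀ l ∈ Finset.range (2 ^ j),
      Integrable (fun x => (∫ y, f y * B.φ j l y ∂μI) * (B.φ j l x * B.ψ j k x)) μI :=
    fun l hl => ((B.memLp_φ j hj l (Finset.mem_range.1 hl)).integrable_mul hψ).const_mul _
  have hK : ∀ x, (B.K j f x - f x) * B.ψ j k x =
      (∑ l ∈ Finset.range (2 ^ j), (∫ y, f y * B.φ j l y ∂μI) * (B.φ j l x * B.ψ j k x)) -
        f x * B.ψ j k x := fun x => by
    rw [sub_mul, K, Finset.sum_mul]
    simp only [mul_assoc]
  have hfψ : Integrable (fun x => f x * B.ψ j k x) μI := hf.integrable_mul hψ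
  simp only [hK]
  rw [integral_sub (integrable_finsetSum _ hint) hfψ, integral_finsetSum _ hint,
    Finset.sum_eq_zero, zero_sub]
  intro l hl
  rw [integral_const_mul, B.orth_φψ j hj l (Finset.mem_range.1 hl) k hk, mul_zero]

/-- Hölder duality: `|⟨f, ψ_{j0}⟩| = |⟨K_j f - f, ψ_{j0}⟩| ≤ ‖K_j f - f‖_∞ ‖ψ_{j0}‖₁`. With `C` the
constant of the `L¹` bound, `ε = R / C` depends on `R` and the basis alone. -/
theorem exists_le_eLpNorm_K_sub (β R : ℝ) (hR : 0 < R) : ∃ ε : ℝ, 0 < ε ∧ ∀ f, MemLp f 2 μI →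
    ∀ j, B.J0 ≤ j → R * (2 : ℝ) ^ (-(j : ℝ) * (β + 1 / 2)) ≤ |∫ x, f x * B.ψ j 0 x ∂μI| →
    ENNReal.ofReal (ε * (2 : ℝ) ^ (-(j : ℝ) * β)) ≤ eLpNorm (fun x => B.K j f x - f x) ∞ μI := by
  obtain ⟨C, hC, hψ⟩ := B.exists_lintegral_enorm_ψ_le
  refine ⟨R / C, by positivity, fun f hf j hj hle => ?_⟩
  set S := eLpNorm (fun x => B.K j f x - f x) ∞ μI with hS
  have h1 : ENNReal.ofReal (R * (2 : ℝ) ^ (-(j : ℝ) * (β + 1 / 2))) ≤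
      S * ENNReal.ofReal (C * (2 : ℝ) ^ (-(j : ℝ) / 2)) := by
    calc _ ≤ ‖∫ x, (B.K j f x - f x) * B.ψ j 0 x ∂μI‖ₑ := by
          rw [B.integral_K_sub_mul_ψ hf hj (by positivity), enorm_neg, Real.enorm_eq_ofReal_abs]
          exact ENNReal.ofReal_le_ofReal hle
      _ ≤ ∫⁻ x, ‖(B.K j f x - f x) * B.ψ j 0 x‖ₑ ∂μI := enorm_integral_le_lintegral_enorm _
      _ ≤ ∫⁻ x, S * ‖B.ψ j 0 x‖ₑ ∂μI := by
          refine lintegral_mono_ae ?_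
          rw [hS, eLpNorm_exponent_top]
          filter_upwards [enorm_ae_le_eLpNormEssSup (fun x => B.K j f x - f x) μI] with x hx
          rw [enorm_mul]
          gcongr
      _ = S * ∫⁻ x, ‖B.ψ j 0 x‖ₑ ∂μI :=
          lintegral_const_mul'' _ (B.memLp_ψ j hj 0 (by positivity)).1.enorm
      _ ≤ _ := by gcongr; exact hψ j hj
  have hpos : 0 < C * (2 : ℝ) ^ (-(j : ℝ) / 2) := by positivity
  rw [← ENNReal.div_le_iff (by simpa using hpos) ENNReal.ofReal_ne_top,
    ← ENNReal.ofReal_div_of_pos hpos] at h1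
  refine le_trans (le_of_eq ?_) h1
  congr 1
  rw [mul_div_mul_comm, ← Real.rpow_sub (by norm_num)]
  congr 2
  ring

end WaveletBasis

end SlabSpikeBvM

namespace SlabSpikeBvM

/-! ### Gaussian tails and concentration of white noise on `𝓜₀(w)` -/

theorem gaussianReal_abs_sub_ge_le (m : ℝ) {v : ℝ≥0} (hv : v ≠ 0) {t : ℝ} (ht : 0 ≤ t) :
    gaussianReal m v {y | t ≤ |y - m|} ≤ ENNReal.ofReal (2 * Real.exp (-(t ^ 2 / (2 * v)))) := by
  have hv' : (0 : ℝ) < v := by positivity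
  have hexp : ∀ s, mgf (fun ω => ω) (gaussianReal m v) s = Real.exp (m * s + v * s ^ 2 / 2) :=
    fun s => congrFun mgf_id_gaussianReal s
  have h1 : (gaussianReal m v).real {y | m + t ≤ id y} ≤ Real.exp (-(t ^ 2 / (2 * v))) := by
    refine (measure_ge_le_exp_mul_mgf (m + t) (t := t / v) (by positivity)
      -- The Chernoff parameter `t / v` is the optimal one for variance `v`.
      (integrable_exp_mul_gaussianReal _)).trans_eq ?_
    rw [hexp, ← Real.exp_add]
    congr 1
    field_simp
    ring
  have h2 : (gaussianReal m v).real {y | id y ≤ m - t} ≤ Real.exp (-(t ^ 2 / (2 * v))) := by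
    refine (measure_le_le_exp_mul_mgf (m - t) (t := -(t / v)) (by simp; positivity)
      (integrable_exp_mul_gaussianReal _)).trans_eq ?_
    rw [hexp, ← Real.exp_add]
    congr 1
    field_simp
    ring
  have hsub : {y : ℝ | t ≤ |y - m|} ⊆ {y | m + t ≤ id y} ∪ {y | id y ≤ m - t} := by
    intro y hy
    rcases le_abs.1 (show t ≤ |y - m| from hy) with h | h
    · left; simp only [id, Set.mem_ofPred_eq]; linarith
    · right; simp only [id, Set.mem_ofPred_eq]; linarith
  rw [← ofReal_measureReal]
  refine ENNReal.ofReal_le_ofReal (((measureReal_mono hsub).trans (measureReal_union_le _ _)).trans ?_)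
  linarith

/-- Eventually `δ w_l ≥ 2√l`, so the Gaussian factor is at most `e^(-2l)`, which beats the number
`2^l ≤ e^l` of coordinates at level `l`. -/
theorem summable_two_pow_mul_exp_weight {w : Weight} (hw : w.Admissible) {δ : ℝ} (hδ : 0 < δ) :
    Summable fun l : ℕ => (2 : ℝ) ^ l * (2 * Real.exp (-((δ * w.w l) ^ 2 / 2))) := by
  refine summable_of_isBigO_nat Real.summable_exp_neg_nat (Asymptotics.IsBigO.of_bound 2 ?_)
  filter_upwards [hw.2.eventually_ge_atTop (2 / δ), eventually_ge_atTop 1] with l hl hl1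
  have hl0 : (0 : ℝ) < l := by exact_mod_cast hl1
  have hs := Real.sqrt_pos.2 hl0
  rw [div_le_div_iff₀ hδ hs] at hl
  have h4 : 4 * (l : ℝ) ≤ (δ * w.w l) ^ 2 := by
    calc 4 * (l : ℝ) = (2 * √(l : ℝ)) ^ 2 := by rw [mul_pow, Real.sq_sqrt hl0.le]; norm_num
      _ ≤ _ := by
        rw [mul_comm δ]
        exact pow_le_pow_left₀ (by positivity) hl 2
  have h2 : (2 : ℝ) ^ l ≤ Real.exp l := by
    rw [← Real.exp_one_pow]
    exact pow_le_pow_left₀ (by norm_num) (by linarith [Real.exp_one_gt_d9]) l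
  rw [Real.norm_of_nonneg (by positivity), Real.norm_of_nonneg (by positivity)]
  calc (2 : ℝ) ^ l * (2 * Real.exp (-((δ * w.w l) ^ 2 / 2)))
      ≤ Real.exp l * (2 * Real.exp (-(2 * l))) := by
        gcongr
        linarith
    _ = 2 * Real.exp (-l) := by
        rw [mul_left_comm, ← Real.exp_add]
        ring_nf

instance (J0 : ℕ) : IsProbabilityMeasure (whiteNoise J0) := by
  unfold whiteNoise; infer_instance

theorem whiteNoise_eval_preimage {J0 : ℕ} (i : Idx J0) {S : Set ℝ} (hS : MeasurableSet S) :
    whiteNoise J0 {x | x i ∈ S} = gaussianReal 0 1 S := by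
  rw [← (measurePreserving_eval_infinitePi (fun _ : Idx J0 => gaussianReal 0 1) i).measure_preimage
    hS.nullMeasurableSet]
  rfl

/-- First Borel–Cantelli lemma with the Gaussian tails summed level by level. -/
theorem ae_whiteNoise_finite {J0 : ℕ} {w : Weight} (hw : w.Admissible) {δ : ℝ} (hδ : 0 < δ) :
    ∀ᵐ x ∂whiteNoise J0, {i : Idx J0 | δ * w.w (level i) ≤ |x i|}.Finite := by
  refine ae_finite_setOfPred_mem (s := fun i => {x : Idx J0 → ℝ | δ * w.w (level i) ≤ |x i|}) ?_
  have hs : Summable fun i : Idx J0 => 2 * Real.exp (-((δ * w.w (level i)) ^ 2 / 2)) := by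
    refine summable_of_sum_level_le (fun _ => by positivity)
      ((summable_nat_add_iff J0).2 (summable_two_pow_mul_exp_weight hw hδ)) fun i => ?_
    simp [level, add_comm]
  refine ne_top_of_le_ne_top hs.tsum_ofReal_ne_top (ENNReal.tsum_le_tsum fun i => ?_)
  have h := gaussianReal_abs_sub_ge_le 0 (v := 1) one_ne_zero
    (mul_nonneg hδ.le (w.pos (level i)).le)
  simp only [sub_zero, NNReal.coe_one, mul_one] at h
  exact (whiteNoise_eval_preimage i (S := {y | δ * w.w (level i) ≤ |y|})
    (measurableSet_le measurable_const measurable_abs)).le.trans h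

theorem whiteNoise_compl_range_val {J0 : ℕ} {w : Weight} (hw : w.Admissible) :
    whiteNoise J0 (Set.range (MZero.val : MZero J0 w → Idx J0 → ℝ))ᶜ = 0 := by
  rw [← mem_ae_iff]
  filter_upwards [ae_all_iff.2 fun n : ℕ =>
    ae_whiteNoise_finite (J0 := J0) hw (Nat.one_div_pos_of_nat (α := ℝ) (n := n))] with x hx
  refine ⟨⟨x, fun δ hδ => ?_⟩, rfl⟩
  obtain ⟨n, hn⟩ := exists_nat_one_div_lt hδ
  refine ⟨(hx n).toFinset.sup level + 1, fun i hi => ?_⟩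
  by_contra hc
  have hmem : i ∈ (hx n).toFinset := by
    rw [Set.Finite.mem_toFinset, Set.mem_ofPred_eq]
    rw [not_le, lt_div_iff₀ (w.pos _)] at hc
    exact (mul_le_mul_of_nonneg_right hn.le (w.pos _).le).trans hc.le
  have := Finset.le_sup (f := level) hmem
  omega

theorem MZero.val_injective {J0 : ℕ} {w : Weight} :
    Function.Injective (MZero.val : MZero J0 w → Idx J0 → ℝ) := fun _ _ h => MZero.ext h

theorem measurable_val {J0 : ℕ} {w : Weight} :
    Measurable (MZero.val : MZero J0 w → Idx J0 → ℝ) := comap_measurable _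

/-- On the posterior side an upper bound is enough, so it need not be known that `μ` is concentrated
on `𝓜₀(w)`. -/
theorem onMZero_preimage_val_le {J0 : ℕ} {w : Weight} (μ : Measure (Idx J0 → ℝ))
    {T : Set (Idx J0 → ℝ)} (hT : MeasurableSet T) :
    onMZero w μ (MZero.val ⁻¹' T) ≤ μ T :=
  (Measure.comap_apply_le _ _ (measurable_val hT).nullMeasurableSet).trans
    (measure_mono (Set.image_preimage_subset _ _))

theorem onMZero_whiteNoise_preimage_val {J0 : ℕ} {w : Weight} (hw : w.Admissible)
    {T : Set (Idx J0 → ℝ)} (hT : MeasurableSet T) :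
    onMZero w (whiteNoise J0) (MZero.val ⁻¹' T) = whiteNoise J0 T := by
  have h0 := whiteNoise_compl_range_val (J0 := J0) hw
  have hnull : NullMeasurableSet (Set.range (MZero.val : MZero J0 w → Idx J0 → ℝ)) (whiteNoise J0) :=
    (NullMeasurableSet.of_null h0).of_compl
  rw [onMZero, Measure.comap_apply₀ _ _ MZero.val_injective _ (measurable_val hT).nullMeasurableSet,
    Set.image_preimage_eq_inter_range, measure_inter_conull h0]
  rintro _ ⟨S, hS, rfl⟩
  rw [Set.image_preimage_eq_inter_range]
  exact hS.nullMeasurableSet.inter hnull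

/-! ### A lower bound for the bounded Lipschitz distance to white noise -/

/-- The bump `½ (1 - |x_i| / w_l)₊` at a single coordinate. -/
noncomputable def bump {J0 : ℕ} (w : Weight) (i : Idx J0) (s : MZero J0 w) : ℝ :=
  1 / 2 * max 0 (1 - |s.val i| / w.w (level i))

theorem bump_nonneg {J0 : ℕ} {w : Weight} (i : Idx J0) (s : MZero J0 w) : 0 ≤ bump w i s := by
  unfold bump; positivity

theorem bump_le {J0 : ℕ} {w : Weight} (i : Idx J0) (s : MZero J0 w) : bump w i s ≤ 1 / 2 := by
  have : 0 ≤ |s.val i| / w.w (level i) := div_nonneg (abs_nonneg _) (w.pos _).le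
  have : max 0 (1 - |s.val i| / w.w (level i)) ≤ 1 := max_le (by norm_num) (by linarith)
  unfold bump; linarith

theorem bLUnit_bump {J0 : ℕ} (w : Weight) (i : Idx J0) : BLUnit (bump w i) := by
  refine ⟨1 / 2, 1 / 2, by norm_num, by norm_num, by norm_num, fun s => ?_, fun s t => ?_⟩
  · rw [abs_of_nonneg (bump_nonneg i s)]
    exact bump_le i s
  · have hd := (MZero.dist_le_iff s t dist_nonneg).1 le_rfl i
    rw [bump, bump, ← mul_sub, abs_mul, abs_of_pos (by norm_num : (0 : ℝ) < 1 / 2)]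
    refine mul_le_mul_of_nonneg_left (le_trans ?_ hd) (by norm_num)
    rw [max_comm, max_comm 0]
    refine (abs_max_sub_max_le_abs _ _ _).trans ?_
    rw [show 1 - |s.val i| / w.w (level i) - (1 - |t.val i| / w.w (level i)) =
      (|t.val i| - |s.val i|) / w.w (level i) by ring, abs_div, abs_of_pos (w.pos _),
      abs_sub_comm (s.val i)]
    exact div_le_div_of_nonneg_right (abs_abs_sub_abs_le_abs_sub _ _) (w.pos _).le

theorem measurable_bump {J0 : ℕ} (w : Weight) (i : Idx J0) : Measurable (bump w i) := by
  have : Measurable fun s : MZero J0 w => s.val i := (measurable_pi_apply i).comp measurable_val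
  unfold bump
  fun_prop

/-- The bump tests the two measures. It vanishes where `|x_i| ≥ w_l`, and since `w_l ≥ 1` it is at
least 1/4 where `|x_i| ≤ 1/2`, an event whose white noise probability does not depend on the level.
-/
theorem le_blDist_whiteNoise {J0 : ℕ} {w : Weight} (hw : w.Admissible) (i : Idx J0)
    (μ : Measure (Idx J0 → ℝ)) [IsProbabilityMeasure μ] :
    ENNReal.ofReal ((gaussianReal 0 1).real {y | |y| ≤ 1 / 2} / 4) ≤
      blDist (onMZero w μ) (onMZero w (whiteNoise J0)) + μ {x | |x i| < w.w (level i)} := by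
  have hc : ∀ c : ℝ, MeasurableSet {x : Idx J0 → ℝ | |x i| < c} := fun c =>
    measurableSet_lt (by fun_prop) measurable_const
  have hc' : MeasurableSet {x : Idx J0 → ℝ | |x i| ≤ 1 / 2} :=
    measurableSet_le (by fun_prop) measurable_const
  have hfin : ∀ ν : Measure (Idx J0 → ℝ), IsProbabilityMeasure ν → IsFiniteMeasure (onMZero w ν) :=
    fun ν _ => ⟨(onMZero_preimage_val_le ν MeasurableSet.univ).trans_lt (by simp)⟩
  have := hfin μ inferInstance
  have := hfin (whiteNoise J0) inferInstance
  have hint : ∀ ν : Measure (MZero J0 w), IsFiniteMeasure ν → Integrable (bump w i) ν := fun ν _ =>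
    Integrable.of_bound (measurable_bump w i).aestronglyMeasurable (1 / 2) (ae_of_all _ fun s => by
      rw [Real.norm_of_nonneg (bump_nonneg i s)]; exact bump_le i s)
  set A : Set (MZero J0 w) := MZero.val ⁻¹' {x | |x i| < w.w (level i)} with hA
  set D : Set (MZero J0 w) := MZero.val ⁻¹' {x | |x i| ≤ 1 / 2} with hD
  have hAm : MeasurableSet A := measurable_val (hc _)
  have hDm : MeasurableSet D := measurable_val hc'
  have h1 : ∫ s, bump w i s ∂onMZero w μ ≤ μ.real {x | |x i| < w.w (level i)} := by
    calc ∫ s, bump w i s ∂onMZero w μ ≤ ∫ s, A.indicator 1 s ∂onMZero w μ := by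
          refine integral_mono (hint _ inferInstance) ((integrable_const 1).indicator hAm) fun s => ?_
          by_cases hs : s ∈ A
          · rw [Set.indicator_of_mem hs]
            exact (bump_le i s).trans (by norm_num)
          · rw [Set.indicator_of_notMem hs, bump, max_eq_left, mul_zero]
            rw [hA, Set.mem_preimage, Set.mem_ofPred_eq, not_lt] at hs
            rw [sub_nonpos, one_le_div (w.pos _)]
            exact hs
      _ = (onMZero w μ).real A := integral_indicator_one hAm
      _ ≤ _ := ENNReal.toReal_mono (measure_ne_top _ _) (onMZero_preimage_val_le μ (hc _))
  have h2 : (gaussianReal 0 1).real {y | |y| ≤ 1 / 2} / 4 ≤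
      ∫ s, bump w i s ∂onMZero w (whiteNoise J0) := by
    rw [measureReal_def]
    calc ((gaussianReal 0 1) {y | |y| ≤ 1 / 2}).toReal / 4
        = ∫ s, D.indicator (fun _ => 1 / 4) s ∂onMZero w (whiteNoise J0) := by
          rw [integral_indicator_const _ hDm, measureReal_def (onMZero w _), hD,
            onMZero_whiteNoise_preimage_val hw hc',
            ← whiteNoise_eval_preimage i (S := {y | |y| ≤ 1 / 2})
              (measurableSet_le measurable_abs measurable_const), smul_eq_mul]
          simp only [Set.mem_ofPred_eq]
          ring
      _ ≤ _ := by
          refine integral_mono ((integrable_const _).indicator hDm) (hint _ inferInstance)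
            fun s => ?_
          by_cases hs : s ∈ D
          · rw [Set.indicator_of_mem hs]
            have hs' : |s.val i| ≤ 1 / 2 := hs
            have : |s.val i| / w.w (level i) ≤ 1 / 2 :=
              (div_le_self (abs_nonneg _) (w.one_le _)).trans hs'
            have := le_max_right 0 (1 - |s.val i| / w.w (level i))
            simp only [bump]
            linarith
          · rw [Set.indicator_of_notMem hs]
            exact bump_nonneg i s
  have h3 : ENNReal.ofReal |∫ s, bump w i s ∂onMZero w μ - ∫ s, bump w i s ∂onMZero w (whiteNoise J0)|
      ≤ blDist (onMZero w μ) (onMZero w (whiteNoise J0)) :=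
    le_iSup₂_of_le (bump w i) (bLUnit_bump w i) le_rfl
  refine le_trans ?_ (add_le_add_left h3 _)
  rw [← ofReal_measureReal (μ := μ), ← ENNReal.ofReal_add (abs_nonneg _) measureReal_nonneg]
  refine ENNReal.ofReal_le_ofReal ?_
  have := neg_abs_le (∫ s, bump w i s ∂onMZero w μ - ∫ s, bump w i s ∂onMZero w (whiteNoise J0))
  linarith

end SlabSpikeBvM

namespace SlabSpikeBvM

/-! ### The posterior under product priors -/

/-- The likelihood ratio of a single coordinate. -/
noncomputable def coordLikelihood (n : ℕ) (y θ : ℝ) : ℝ≥0∞ :=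
  ENNReal.ofReal (Real.exp ((n : ℝ) * (y * θ) - (n : ℝ) * θ ^ 2 / 2))

theorem measurable_coordLikelihood (n : ℕ) (y : ℝ) : Measurable (coordLikelihood n y) := by
  unfold coordLikelihood; fun_prop

theorem coordLikelihood_le (n : ℕ) (y θ : ℝ) :
    coordLikelihood n y θ ≤ ENNReal.ofReal (Real.exp (n * y ^ 2 / 2)) := by
  refine ENNReal.ofReal_le_ofReal (Real.exp_le_exp.2 ?_)
  nlinarith [mul_nonneg (Nat.cast_nonneg (α := ℝ) n) (sq_nonneg (y - θ))]

theorem coordLikelihood_ne_zero (n : ℕ) (y θ : ℝ) : coordLikelihood n y θ ≠ 0 := by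
  simp [coordLikelihood, Real.exp_pos]

theorem lintegral_coordLikelihood_ne_top (n : ℕ) (y : ℝ) (ν : Measure ℝ) [IsProbabilityMeasure ν] :
    ∫⁻ θ, coordLikelihood n y θ ∂ν ≠ ∞ :=
  ne_top_of_le_ne_top (by simp) (lintegral_mono (coordLikelihood_le n y))

theorem lintegral_coordLikelihood_ne_zero (n : ℕ) (y : ℝ) (ν : Measure ℝ)
    [IsProbabilityMeasure ν] : ∫⁻ θ, coordLikelihood n y θ ∂ν ≠ 0 := by
  rw [Ne, lintegral_eq_zero_iff (measurable_coordLikelihood n y)]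
  intro h
  obtain ⟨θ, hθ⟩ := h.exists
  exact coordLikelihood_ne_zero n y θ hθ

theorem likelihood_eq_prod {J0 : ℕ} {n : ℕ} {F : Finset (Idx J0)} (Y : Idx J0 → ℝ)
    {f : Idx J0 → ℝ} (hf : ∀ k ∉ F, f k = 0) :
    likelihood n Y f = ∏ k ∈ F, coordLikelihood n (Y k) (f k) := by
  rw [likelihood, tsum_eq_sum (s := F) fun k hk => by simp [hf k hk], Real.exp_sum,
    ENNReal.ofReal_prod_of_nonneg fun _ _ => (Real.exp_pos _).le]
  rfl

/-- Prior and likelihood both factorize over the finitely many active coordinates, so all factors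
but the `i`-th cancel in Bayes' formula. -/
theorem posterior_infinitePi_eval {J0 n : ℕ} {ν : Idx J0 → Measure ℝ}
    [∀ i, IsProbabilityMeasure (ν i)] {F : Finset (Idx J0)} (hF : ∀ k ∉ F, ν k = Measure.dirac 0)
    (Y : Idx J0 → ℝ) {i : Idx J0} (hi : i ∈ F) {S : Set ℝ} (hS : MeasurableSet S) :
    posterior (Measure.infinitePi ν) n Y {f | f i ∈ S} =
      (∫⁻ θ, coordLikelihood n (Y i) θ ∂ν i)⁻¹ * ∫⁻ θ in S, coordLikelihood n (Y i) θ ∂ν i := by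
  classical
  set D := ∏ k ∈ F.erase i, ∫⁻ θ, coordLikelihood n (Y k) θ ∂ν k with hD
  have hae : ∀ᵐ f ∂Measure.infinitePi ν, ∀ k ∉ F, f k = 0 := by
    refine ae_all_iff.2 fun k => ?_
    by_cases hk : k ∈ F
    · exact ae_of_all _ fun f h => absurd hk h
    · have hk0 : ∀ᵐ θ ∂ν k, θ = 0 := by
        rw [hF k hk, ae_dirac_eq]
        exact rfl
      filter_upwards [(measurePreserving_eval_infinitePi ν k).quasiMeasurePreserving.ae hk0]
        with f hf _ using hf
  have key : ∀ T : Set ℝ, MeasurableSet T → ∫⁻ f in {f | f i ∈ T}, likelihood n Y f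
      ∂Measure.infinitePi ν = (∫⁻ θ in T, coordLikelihood n (Y i) θ ∂ν i) * D := by
    intro T hT
    let X : Idx J0 → ℝ → ℝ≥0∞ := fun k =>
      if k = i then T.indicator (coordLikelihood n (Y i)) else coordLikelihood n (Y k)
    have hX : ∀ k, Measurable (X k) := fun k => by
      by_cases hk : k = i
      · simpa only [X, if_pos hk] using (measurable_coordLikelihood n (Y i)).indicator hT
      · simpa only [X, if_neg hk] using measurable_coordLikelihood n (Y k)
    have hXi : X i = T.indicator (coordLikelihood n (Y i)) := if_pos rfl
    have hXk : ∀ k ∈ F.erase i, X k = coordLikelihood n (Y k) := fun k hk =>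
      if_neg (Finset.ne_of_mem_erase hk)
    have hTm : MeasurableSet {f : Idx J0 → ℝ | f i ∈ T} := measurable_pi_apply i hT
    calc ∫⁻ f in {f | f i ∈ T}, likelihood n Y f ∂Measure.infinitePi ν
        = ∫⁻ f, ∏ k ∈ F, X k (f k) ∂Measure.infinitePi ν := by
          rw [← lintegral_indicator hTm]
          refine lintegral_congr_ae ?_
          filter_upwards [hae] with f hf
          have hprod : ∏ k ∈ F.erase i, X k (f k) =
              ∏ k ∈ F.erase i, coordLikelihood n (Y k) (f k) :=
            Finset.prod_congr rfl fun k hk => by rw [hXk k hk]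
          rw [← Finset.mul_prod_erase _ _ hi, hXi, hprod]
          by_cases hfT : f i ∈ T
          · rw [Set.indicator_of_mem (show f ∈ {f : Idx J0 → ℝ | f i ∈ T} from hfT),
              Set.indicator_of_mem hfT, likelihood_eq_prod Y hf, ← Finset.mul_prod_erase _ _ hi]
          · rw [Set.indicator_of_notMem (show f ∉ {f : Idx J0 → ℝ | f i ∈ T} from hfT),
              Set.indicator_of_notMem hfT, zero_mul]
      _ = ∏ k ∈ F, ∫⁻ f, X k (f k) ∂Measure.infinitePi ν :=
          lintegral_prod_eq_prod_lintegral_of_indepFun F (fun k (f : Idx J0 → ℝ) => X k (f k))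
            (iIndepFun_infinitePi hX) fun k => (hX k).comp (measurable_pi_apply k)
      _ = ∏ k ∈ F, ∫⁻ θ, X k θ ∂ν k := Finset.prod_congr rfl fun k _ =>
          (measurePreserving_eval_infinitePi ν k).lintegral_comp (hX k)
      _ = _ := by
          rw [← Finset.mul_prod_erase _ _ hi, hXi, lintegral_indicator hT, hD]
          congr 1
          exact Finset.prod_congr rfl fun k hk => by rw [hXk k hk]
  have hSm : MeasurableSet {f : Idx J0 → ℝ | f i ∈ S} := measurable_pi_apply i hS
  have hD0 : D ≠ 0 := Finset.prod_ne_zero_iff.2 fun k _ => lintegral_coordLikelihood_ne_zero _ _ _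
  have hDt : D ≠ ∞ := ENNReal.prod_ne_top fun k _ => lintegral_coordLikelihood_ne_top _ _ _
  -- The normalizing constant is the case of no restriction and carries the same factor `D`.
  have huniv := key Set.univ MeasurableSet.univ
  simp only [Set.mem_univ, Set.ofPred_true, Measure.restrict_univ] at huniv
  rw [posterior, Measure.smul_apply, withDensity_apply _ hSm,
    key S hS, huniv, smul_eq_mul, ENNReal.mul_inv (Or.inr hDt) (Or.inr hD0), mul_mul_mul_comm,
    ENNReal.inv_mul_cancel hD0 hDt, mul_one]

theorem isProbabilityMeasure_posterior {J0 n : ℕ} {ν : Idx J0 → Measure ℝ}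
    [∀ i, IsProbabilityMeasure (ν i)] {F : Finset (Idx J0)} (hF : ∀ k ∉ F, ν k = Measure.dirac 0)
    (Y : Idx J0 → ℝ) {i : Idx J0} (hi : i ∈ F) :
    IsProbabilityMeasure (posterior (Measure.infinitePi ν) n Y) := by
  refine ⟨?_⟩
  have := posterior_infinitePi_eval (n := n) hF Y hi MeasurableSet.univ
  simp only [Set.mem_univ, Set.ofPred_true, Measure.restrict_univ] at this
  rw [this, ENNReal.inv_mul_cancel (lintegral_coordLikelihood_ne_zero _ _ _)
    (lintegral_coordLikelihood_ne_top _ _ _)]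

/-! ### Marginal posteriors under the slab and spike prior -/

theorem lintegral_coordLikelihood_volume {n : ℕ} (hn : 0 < n) (y : ℝ) :
    ∫⁻ θ, coordLikelihood n y θ =
      ENNReal.ofReal (Real.exp (n * y ^ 2 / 2) * √(2 * Real.pi / n)) := by
  have hn' : (0 : ℝ) < n := by exact_mod_cast hn
  have h : ∀ θ, coordLikelihood n y θ = ENNReal.ofReal (Real.exp (n * y ^ 2 / 2)) *
      ENNReal.ofReal (Real.exp (-((n : ℝ) / 2) * (θ - y) ^ 2)) := fun θ => by
    rw [coordLikelihood, ← ENNReal.ofReal_mul (Real.exp_pos _).le, ← Real.exp_add]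
    congr 2
    ring
  simp only [h]
  rw [lintegral_const_mul' _ _ ENNReal.ofReal_ne_top, lintegral_sub_right_eq_self
    (fun θ => ENNReal.ofReal (Real.exp (-((n : ℝ) / 2) * θ ^ 2))) y,
    ← ofReal_integral_eq_lintegral_ofReal (integrable_exp_neg_mul_sq (by positivity))
      (ae_of_all _ fun _ => (Real.exp_pos _).le), integral_gaussian,
    ← ENNReal.ofReal_mul (Real.exp_pos _).le]
  congr 3
  field_simp

namespace SlabSpike

variable {j0 : ℕ → ℕ} (P : SlabSpike j0)

instance : IsProbabilityMeasure P.slab := ⟨by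
  rw [slab, withDensity_apply _ MeasurableSet.univ, Measure.restrict_univ, P.lintegral_g]⟩

theorem wt_nonneg {n j : ℕ} (hj0 : j0 n < j) (hj : j ≤ Nat.log 2 n) : 0 ≤ P.wt j n :=
  (Real.rpow_nonneg (Nat.cast_nonneg n) _).trans (P.lower n j hj0 hj)

theorem wt_le_half {n j : ℕ} (hj0 : j0 n < j) (hj : j ≤ Nat.log 2 n) : P.wt j n ≤ 1 / 2 := by
  refine (P.upper n j hj0 hj).trans ?_
  have h1 : (1 : ℝ) ≤ j := by exact_mod_cast (Nat.zero_le _).trans_lt hj0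
  have := P.half_lt_τ
  calc (2 : ℝ) ^ (-(j : ℝ) * (1 + P.τ)) ≤ 2 ^ (-1 : ℝ) :=
        Real.rpow_le_rpow_of_exponent_le (by norm_num) (by nlinarith)
    _ = 1 / 2 := by rw [Real.rpow_neg_one]; norm_num

instance isProbabilityMeasure_marginal (n j : ℕ) : IsProbabilityMeasure (P.marginal n j) := by
  unfold marginal
  split_ifs with h1 h2
  · infer_instance
  · have h0 := P.wt_nonneg (not_le.1 h1) h2
    have hh := P.wt_le_half (not_le.1 h1) h2
    refine ⟨?_⟩
    simp only [Measure.add_apply, Measure.smul_apply, measure_univ, smul_eq_mul, mul_one]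
    rw [← ENNReal.ofReal_add (by linarith) h0]
    simp
  · infer_instance

theorem lintegral_coordLikelihood_slab_le {C : ℝ} (hC : ∀ x, P.g x ≤ C) {n : ℕ} (hn : 0 < n)
    (y : ℝ) : ∫⁻ θ, coordLikelihood n y θ ∂P.slab ≤
      ENNReal.ofReal (C * (Real.exp (n * y ^ 2 / 2) * √(2 * Real.pi / n))) := by
  have hC0 : 0 ≤ C := (P.pos_g 0).le.trans (hC 0)
  rw [slab, lintegral_withDensity_eq_lintegral_mul _ P.measurable_g.ennreal_ofReal
    (measurable_coordLikelihood n y), ENNReal.ofReal_mul hC0,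
    ← lintegral_coordLikelihood_volume hn, ← lintegral_const_mul' _ _ ENNReal.ofReal_ne_top]
  refine lintegral_mono fun θ => ?_
  simp only [Pi.mul_apply]
  gcongr
  exact hC θ

theorem marginal_eq_dirac {n j : ℕ} (hj0 : j0 n < j) (hj : Nat.log 2 n < j) :
    P.marginal n j = Measure.dirac 0 := by
  rw [marginal, if_neg (not_le.2 hj0), if_neg (not_le.2 hj)]

/-- The likelihood ratio is 1 at the spike, so the denominator is at least `1 - w_{jn}`; the
numerator has only the slab, with weight `w_{jn} ≤ 1 - w_{jn}`. The weights cancel, and boundedness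
of `g` leaves a Gaussian integral. -/
theorem marginal_ratio_le {C : ℝ} (hC : ∀ x, P.g x ≤ C) {n j : ℕ} (hn : 0 < n) (hj0 : j0 n < j)
    (hj : j ≤ Nat.log 2 n) (y : ℝ) :
    (∫⁻ θ, coordLikelihood n y θ ∂P.marginal n j)⁻¹ *
      ∫⁻ θ in {0}ᶜ, coordLikelihood n y θ ∂P.marginal n j ≤
      ENNReal.ofReal (C * (Real.exp (n * y ^ 2 / 2) * √(2 * Real.pi / n))) := by
  have h0 := P.wt_nonneg hj0 hj
  have hh := P.wt_le_half hj0 hj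
  have hden : ENNReal.ofReal (1 - P.wt j n) ≤ ∫⁻ θ, coordLikelihood n y θ ∂P.marginal n j := by
    rw [marginal, if_neg (not_le.2 hj0), if_pos hj, lintegral_add_measure, lintegral_smul_measure,
      lintegral_dirac' _ (measurable_coordLikelihood n y)]
    simp [coordLikelihood]
  have hdirac : (Measure.dirac (0 : ℝ)).restrict {0}ᶜ = 0 := by
    rw [Measure.restrict_eq_zero]
    simp
  have hnum : ∫⁻ θ in {0}ᶜ, coordLikelihood n y θ ∂P.marginal n j ≤
      ENNReal.ofReal (1 - P.wt j n) * ∫⁻ θ, coordLikelihood n y θ ∂P.slab := by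
    rw [marginal, if_neg (not_le.2 hj0), if_pos hj, Measure.restrict_add, Measure.restrict_smul,
      Measure.restrict_smul, lintegral_add_measure, lintegral_smul_measure, lintegral_smul_measure,
      hdirac, lintegral_zero_measure, smul_zero, zero_add, smul_eq_mul]
    exact mul_le_mul' (ENNReal.ofReal_le_ofReal (by linarith)) (setLIntegral_le_lintegral _ _)
  refine (mul_le_mul' (ENNReal.inv_le_inv.2 hden) hnum).trans ?_
  rw [← mul_assoc, ENNReal.inv_mul_cancel (by simp; linarith) ENNReal.ofReal_ne_top, one_mul]
  exact P.lintegral_coordLikelihood_slab_le hC hn y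

end SlabSpike

section

variable (P : SlabSpike (fun _ => 0)) {J0 n : ℕ}

theorem SlabSpike.isProbabilityMeasure_posterior (hn : J0 + 1 ≤ Nat.log 2 n) (Y : Idx J0 → ℝ) :
    IsProbabilityMeasure (posterior (P.prior J0 n) n Y) := by
  refine SlabSpikeBvM.isProbabilityMeasure_posterior
    (F := (finite_level_lt J0 (Nat.log 2 n + 1)).toFinset) (fun k hk => ?_) Y
    (i := Sum.inr ⟨0, ⟨0, by positivity⟩⟩) ?_
  · simp only [Set.Finite.mem_toFinset, Set.mem_ofPred_eq, not_lt] at hk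
    exact P.marginal_eq_dirac (by omega) (by omega)
  · simp only [Set.Finite.mem_toFinset, Set.mem_ofPred_eq, level]
    omega

theorem SlabSpike.posterior_ne_zero_le {C : ℝ} (hC : ∀ x, P.g x ≤ C) {i : Idx J0}
    (hi : 0 < level i) (hin : level i ≤ Nat.log 2 n) (Y : Idx J0 → ℝ) :
    posterior (P.prior J0 n) n Y {f | f i ≠ 0} ≤
      ENNReal.ofReal (C * (Real.exp (n * Y i ^ 2 / 2) * √(2 * Real.pi / n))) := by
  have hn : 0 < n := Nat.pos_of_ne_zero fun h => by simp [h] at hin; omega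
  have h := posterior_infinitePi_eval (n := n) (ν := fun i : Idx J0 => P.marginal n (level i))
    (F := (finite_level_lt J0 (Nat.log 2 n + 1)).toFinset) (fun k hk => by
      simp only [Set.Finite.mem_toFinset, Set.mem_ofPred_eq, not_lt] at hk
      exact P.marginal_eq_dirac (by omega) (by omega)) Y (i := i) (by
      simp only [Set.Finite.mem_toFinset, Set.mem_ofPred_eq]; omega)
      (MeasurableSet.singleton (0 : ℝ)).compl
  exact h.le.trans (P.marginal_ratio_le hC hn hi hin (Y i))

end

end SlabSpikeBvM

namespace SlabSpikeBvM

/-! ### The self-similar function -/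

/-- The sequence with entries `a i` and `b i` at the positions `0` and `1` of level `J0 + i`, and
zero elsewhere. -/
def twoPerLevel {J0 : ℕ} (a b : ℕ → ℝ) : Idx J0 → ℝ
  | Sum.inl _ => 0
  | Sum.inr p => if p.2.val = 0 then a p.1 else if p.2.val = 1 then b p.1 else 0

theorem sum_fin_ite_val_eq_le {N t : ℕ} {r : ℝ} (hr : 0 ≤ r) :
    ∑ k : Fin N, (if k.val = t then r else 0) ≤ r := by
  rw [Fin.sum_univ_eq_sum_range (fun k => if k = t then r else 0) N, Finset.sum_ite_eq']
  split_ifs <;> simp [hr]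

theorem summable_abs_twoPerLevel {J0 : ℕ} {a b r : ℕ → ℝ} (hr : Summable r)
    (ha : ∀ i, |a i| ≤ r i) (hb : ∀ i, |b i| ≤ r i) :
    Summable fun i : Idx J0 => |twoPerLevel a b i| := by
  refine summable_of_sum_level_le (fun _ => abs_nonneg _) (hr.mul_left 2) fun i => ?_
  have hri : 0 ≤ r i := (abs_nonneg _).trans (ha i)
  calc ∑ k : Fin (2 ^ (J0 + i)), |twoPerLevel a b (Sum.inr ⟨i, k⟩)|
      ≤ ∑ k : Fin (2 ^ (J0 + i)),
          ((if k.val = 0 then r i else 0) + (if k.val = 1 then r i else 0)) := by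
        refine Finset.sum_le_sum fun k _ => ?_
        simp only [twoPerLevel]
        split_ifs with h0 h1 h1
        · omega
        · simpa using ha i
        · simpa using hb i
        · simp
    _ ≤ 2 * r i := by
        rw [Finset.sum_add_distrib, two_mul]
        exact add_le_add (sum_fin_ite_val_eq_le hri) (sum_fin_ite_val_eq_le hri)

/-- Position 0 of every level carries the extremal coefficient that forces self-similarity, which
leaves position 1 free; hence `ε` does not depend on `b`. -/
theorem WaveletBasis.exists_mem_selfSimilar (B : WaveletBasis) {β R : ℝ} (hβ : 0 < β)
    (hR : 0 < R) : ∃ ε : ℝ, 0 < ε ∧ ∀ b : ℕ → ℝ,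
      (∀ m, |b m| ≤ R * (2 : ℝ) ^ (-((B.J0 + (m + 1) : ℕ) : ℝ) * (β + 1 / 2))) →
      ∀ j₁, ∃ f ∈ B.selfSimilar j₁ β R ε, ∀ (m : ℕ) (h : 1 < 2 ^ (B.J0 + (m + 1))),
        B.coeff f (Sum.inr ⟨m + 1, ⟨1, h⟩⟩) = b m := by
  obtain ⟨ε, hε, hself⟩ := B.exists_le_eLpNorm_K_sub β R hR
  refine ⟨ε, hε, fun b hb j₁ => ?_⟩
  let a : ℕ → ℝ := fun i => R * (2 : ℝ) ^ (-((B.J0 + i : ℕ) : ℝ) * (β + 1 / 2))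
  -- The shift by one skips level `J0`: if `J0 = 0` that level has no position 1 and escapes the
  -- spike.
  let b' : ℕ → ℝ := fun i => Nat.casesOn i 0 b
  have ha0 : ∀ i, 0 < a i := fun i => by positivity
  have ha : ∀ i, |a i| ≤ a i := fun i => (abs_of_pos (ha0 i)).le
  have hb' : ∀ i, |b' i| ≤ a i := fun i => by
    cases i with
    | zero => simpa [b'] using (ha0 0).le
    | succ m => exact hb m
  have hs : Summable a := by
    have hq : (2 : ℝ) ^ (-(β + 1 / 2)) < 1 :=
      Real.rpow_lt_one_of_one_lt_of_neg (by norm_num) (by linarith)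
    refine ((summable_geometric_of_lt_one (by positivity) hq).mul_left
      (R * (2 : ℝ) ^ (-(B.J0 : ℝ) * (β + 1 / 2)))).congr fun i => ?_
    rw [← Real.rpow_natCast, ← Real.rpow_mul (by norm_num), mul_assoc,
      ← Real.rpow_add (by norm_num)]
    simp only [a]
    push_cast
    ring_nf
  obtain ⟨f, hf, hfc⟩ := B.exists_coeff_eq (summable_abs_twoPerLevel (J0 := B.J0) hs ha hb')
  refine ⟨f, ⟨⟨hf, fun i => ?_⟩, fun j _ hj => hself f hf j hj ?_⟩, fun m h => ?_⟩
  · rw [hfc]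
    rcases i with k | ⟨i, k⟩
    · simp only [twoPerLevel, abs_zero]
      positivity
    · simp only [twoPerLevel, level]
      split_ifs
      · exact ha i
      · exact hb' i
      · rw [abs_zero]
        exact (ha0 i).le
  · obtain ⟨i, rfl⟩ := Nat.exists_eq_add_of_le hj
    have h : B.coeff f (Sum.inr ⟨i, ⟨0, by positivity⟩⟩) = a i := by
      rw [hfc]
      simp [twoPerLevel]
    have h' : ∫ x, f x * B.ψ (B.J0 + i) 0 x ∂μI = a i := h
    rw [h']
    exact le_abs_self _
  · rw [hfc]
    simp [twoPerLevel, b']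

/-! ### The sample sizes -/

/-- For a given level, a large sample size makes the prior active there, the planted coefficient
admissible in the Hölder ball, and its rescaled size larger than any prescribed bound. -/
theorem eventually_sample_size (l : ℕ) {r : ℝ} (hr : 0 < r) (M : ℝ) :
    ∀ᶠ n : ℕ in atTop, l ≤ Nat.log 2 n ∧ √(Real.log n / n) / 2 ≤ r ∧ M ≤ √(Real.log n) / 4 := by
  have h1 : ∀ᶠ n : ℕ in atTop, l ≤ Nat.log 2 n := by
    filter_upwards [eventually_ge_atTop (2 ^ l)] with n hn using Nat.le_log_of_pow_le one_lt_two hn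
  have h2 : Tendsto (fun n : ℕ => √(Real.log n / n) / 2) atTop (𝓝 0) := by
    have h : Tendsto (fun n : ℕ => Real.log n / n) atTop (𝓝 0) :=
      Real.isLittleO_log_id_atTop.tendsto_div_nhds_zero.comp tendsto_natCast_atTop_atTop
    simpa using h.sqrt.div_const 2
  have h3 : Tendsto (fun n : ℕ => √(Real.log n) / 4) atTop atTop :=
    (Real.tendsto_sqrt_atTop.comp
      (Real.tendsto_log_atTop.comp tendsto_natCast_atTop_atTop)).atTop_div_const (by norm_num)
  filter_upwards [h1, h2.eventually_le_const hr, h3.eventually_ge_atTop M] with n h1 h2 h3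
    using ⟨h1, h2, h3⟩

/-! ### A coefficient below the detection threshold -/

/-- The event that a coordinate does not deviate much from its mean. -/
def typical {J0 : ℕ} (n : ℕ) (f : Idx J0 → ℝ) (i : Idx J0) : Set (Idx J0 → ℝ) :=
  {Y | |Y i - f i| < √(Real.log n / n) / 4}

theorem measurableSet_typical {J0 : ℕ} (n : ℕ) (f : Idx J0 → ℝ) (i : Idx J0) :
    MeasurableSet (typical n f i) :=
  measurableSet_lt (by fun_prop) measurable_const

instance {J0 : ℕ} (n : ℕ) (f : Idx J0 → ℝ) : IsProbabilityMeasure (dataLaw n f) := by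
  unfold dataLaw; infer_instance

theorem dataLaw_compl_typical_le {J0 n : ℕ} (hn : 0 < n) (f : Idx J0 → ℝ) (i : Idx J0) :
    dataLaw n f (typical n f i)ᶜ ≤ ENNReal.ofReal (2 * (n : ℝ) ^ (-(1 / 32) : ℝ)) := by
  have hn' : (0 : ℝ) < n := by exact_mod_cast hn
  have hlog : 0 ≤ Real.log n := Real.log_natCast_nonneg n
  have hS : MeasurableSet {y : ℝ | √(Real.log n / n) / 4 ≤ |y - f i|} :=
    measurableSet_le measurable_const (by fun_prop)
  have h := gaussianReal_abs_sub_ge_le (f i) (v := (n : ℝ≥0)⁻¹) (by positivity)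
    (show 0 ≤ √(Real.log n / n) / 4 by positivity)
  have heq : dataLaw n f (typical n f i)ᶜ =
      gaussianReal (f i) (n : ℝ≥0)⁻¹ {y | √(Real.log n / n) / 4 ≤ |y - f i|} := by
    rw [← (measurePreserving_eval_infinitePi (fun k : Idx J0 => gaussianReal (f k) (n : ℝ≥0)⁻¹)
      i).measure_preimage hS.nullMeasurableSet]
    congr 1
    ext Y
    simp [typical]
  rw [heq]
  refine h.trans_eq ?_
  congr 2
  -- The exponent is `(log n / (16 n)) · n / 2 = log n / 32`.
  rw [div_pow, Real.sq_sqrt (by positivity), Real.rpow_def_of_pos hn']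
  congr 1
  push_cast
  field_simp
  norm_num
  ring

theorem posterior_ne_zero_le_of_typical (P : SlabSpike (fun _ => 0)) {C : ℝ}
    (hC : ∀ x, P.g x ≤ C) {J0 n : ℕ} {i : Idx J0} (hi : 0 < level i)
    (hin : level i ≤ Nat.log 2 n) {f : Idx J0 → ℝ} (hf : f i = √(Real.log n / n) / 2)
    {Y : Idx J0 → ℝ} (hY : Y ∈ typical n f i) :
    posterior (P.prior J0 n) n Y {f | f i ≠ 0} ≤
      ENNReal.ofReal (C * √(2 * Real.pi) * (n : ℝ) ^ (-(7 / 32) : ℝ)) := by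
  have hn : 0 < n := Nat.pos_of_ne_zero fun h => by simp [h] at hin; omega
  have hn' : (0 : ℝ) < n := by exact_mod_cast hn
  have hlog : 0 ≤ Real.log n := Real.log_natCast_nonneg n
  have hC0 : 0 ≤ C := (P.pos_g 0).le.trans (hC 0)
  refine (P.posterior_ne_zero_le hC hi hin Y).trans (ENNReal.ofReal_le_ofReal ?_)
  rw [mul_assoc]
  refine mul_le_mul_of_nonneg_left ?_ hC0
  have hY' := abs_lt.1 (show |Y i - f i| < _ from hY)
  rw [hf] at hY'
  set s := √(Real.log n / n) with hs
  have hs2 : s ^ 2 = Real.log n / n := Real.sq_sqrt (by positivity)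
  have hs0 : 0 ≤ s := Real.sqrt_nonneg _
  -- Mean `s/2` plus deviation `s/4`. This gives the power `n^(9/32)`, and `√(2π/n)` brings it down
  -- to `n^(-7/32)`.
  have hYsq : Y i ^ 2 ≤ (3 / 4 * s) ^ 2 := sq_le_sq' (by linarith) (by linarith)
  have hexp : n * Y i ^ 2 / 2 ≤ Real.log n * (9 / 32) := by
    calc n * Y i ^ 2 / 2 ≤ n * (3 / 4 * s) ^ 2 / 2 := by gcongr
      _ = Real.log n * (9 / 32) := by
        rw [mul_pow, hs2]
        field_simp
        norm_num
        ring
  calc Real.exp (n * Y i ^ 2 / 2) * √(2 * Real.pi / n)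
      ≤ (n : ℝ) ^ (9 / 32 : ℝ) * √(2 * Real.pi / n) := by
        rw [Real.rpow_def_of_pos hn']
        gcongr
    _ = √(2 * Real.pi) * (n : ℝ) ^ (-(7 / 32) : ℝ) := by
        rw [Real.sqrt_div (by positivity), Real.sqrt_eq_rpow (n : ℝ), mul_div_left_comm,
          ← Real.rpow_sub hn']
        norm_num

theorem le_sqrt_mul_abs_of_typical {J0 n : ℕ} (hn : 0 < n) {i : Idx J0} {f : Idx J0 → ℝ}
    (hf : f i = √(Real.log n / n) / 2) {Y : Idx J0 → ℝ} (hY : Y ∈ typical n f i) :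
    √(Real.log n) / 4 ≤ √(n : ℝ) * |Y i| := by
  have hn' : (0 : ℝ) < √(n : ℝ) := Real.sqrt_pos.2 (by exact_mod_cast hn)
  have hY' := abs_lt.1 (show |Y i - f i| < _ from hY)
  have h : √(Real.log n / n) / 4 ≤ |Y i| := by
    rw [hf] at hY'
    exact le_trans (by linarith) (le_abs_self _)
  rw [Real.sqrt_div (Real.log_natCast_nonneg n), div_right_comm, div_le_iff₀ hn'] at h
  linarith

theorem mul_one_sub_le_lintegral {Ω : Type*} [MeasurableSpace Ω] {μ : Measure Ω}
    [IsProbabilityMeasure μ] {G : Set Ω} (hG : MeasurableSet G) {ρ c : ℝ≥0∞} (hρ : μ Gᶜ ≤ ρ)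
    {h : Ω → ℝ≥0∞} (hc : ∀ y ∈ G, c ≤ h y) : c * (1 - ρ) ≤ ∫⁻ y, h y ∂μ := by
  have hG1 : 1 - ρ ≤ μ G := by
    rw [tsub_le_iff_right, ← prob_add_prob_compl (μ := μ) hG]
    gcongr
  calc c * (1 - ρ) ≤ c * μ G := by gcongr
    _ = ∫⁻ y in G, c ∂μ := (setLIntegral_const _ _).symm
    _ ≤ ∫⁻ y in G, h y ∂μ := setLIntegral_mono' hG hc
    _ ≤ _ := setLIntegral_le_lintegral _ _

section

variable (P : SlabSpike (fun _ => 0)) {C : ℝ} (hC : ∀ x, P.g x ≤ C) {J0 n : ℕ} {i : Idx J0}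
  (hJ : J0 + 1 ≤ Nat.log 2 n) (hi : 0 < level i) (hin : level i ≤ Nat.log 2 n) {f : Idx J0 → ℝ}
  (hf : f i = √(Real.log n / n) / 2) (w : Weight)

include hC hJ hi hin hf

/-- On the typical event the posterior sets the coordinate to zero with high probability, and then
the `i`-th term of the norm is `|Y_i| / w_l`, already at least `M / √n`. -/
theorem le_expectedOutside {M : ℝ} (hM : M * w.w (level i) ≤ √(Real.log n) / 4) :
    (1 - ENNReal.ofReal (C * √(2 * Real.pi) * (n : ℝ) ^ (-(7 / 32) : ℝ))) *
      (1 - ENNReal.ofReal (2 * (n : ℝ) ^ (-(1 / 32) : ℝ))) ≤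
      expectedOutside w (P.prior J0 n) n M f := by
  have hn : 0 < n := Nat.pos_of_ne_zero fun h => by simp [h] at hin; omega
  have hn' : (0 : ℝ) < √(n : ℝ) := Real.sqrt_pos.2 (by exact_mod_cast hn)
  refine mul_one_sub_le_lintegral (measurableSet_typical n f i) (dataLaw_compl_typical_le hn f i)
    fun Y hY => ?_
  have := P.isProbabilityMeasure_posterior hJ Y
  have hm : MeasurableSet {f : Idx J0 → ℝ | f i = 0} :=
    measurableSet_eq_fun (by fun_prop) measurable_const
  calc 1 - ENNReal.ofReal (C * √(2 * Real.pi) * (n : ℝ) ^ (-(7 / 32) : ℝ))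
      ≤ posterior (P.prior J0 n) n Y {f | f i = 0} := by
        rw [tsub_le_iff_right, ← prob_add_prob_compl (μ := posterior (P.prior J0 n) n Y) hm]
        exact add_le_add_right (posterior_ne_zero_le_of_typical P hC hi hin hf hY) _
    _ ≤ _ := by
        refine measure_mono fun g hg => ?_
        rw [Set.mem_ofPred_eq, mNorm]
        refine le_iSup_of_le i (ENNReal.ofReal_le_ofReal ?_)
        rw [show g i = 0 from hg, zero_sub, abs_neg, div_le_div_iff₀ hn' (w.pos _), mul_comm |Y i|]
        exact hM.trans (le_sqrt_mul_abs_of_typical hn hf hY)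

theorem le_lintegral_blDist (hw : w.Admissible) (hM : w.w (level i) ≤ √(Real.log n) / 4) :
    (ENNReal.ofReal ((gaussianReal 0 1).real {y | |y| ≤ 1 / 2} / 4) -
      ENNReal.ofReal (C * √(2 * Real.pi) * (n : ℝ) ^ (-(7 / 32) : ℝ))) *
      (1 - ENNReal.ofReal (2 * (n : ℝ) ^ (-(1 / 32) : ℝ))) ≤
      ∫⁻ Y, blDist (onMZero w (scaledPosterior (P.prior J0 n) n Y))
        (onMZero w (whiteNoise J0)) ∂dataLaw n f := by
  have hn : 0 < n := Nat.pos_of_ne_zero fun h => by simp [h] at hin; omega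
  refine mul_one_sub_le_lintegral (measurableSet_typical n f i) (dataLaw_compl_typical_le hn f i)
    fun Y hY => ?_
  have := P.isProbabilityMeasure_posterior hJ Y
  have hmap : Measurable fun (f : Idx J0 → ℝ) i => √(n : ℝ) * (f i - Y i) := by fun_prop
  have : IsProbabilityMeasure (scaledPosterior (P.prior J0 n) n Y) :=
    Measure.isProbabilityMeasure_map hmap.aemeasurable
  rw [tsub_le_iff_right]
  refine (le_blDist_whiteNoise hw i (scaledPosterior (P.prior J0 n) n Y)).trans
    (add_le_add_right ?_ _)
  refine le_trans ?_ (posterior_ne_zero_le_of_typical P hC hi hin hf hY)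
  rw [scaledPosterior, Measure.map_apply hmap (measurableSet_lt (by fun_prop) measurable_const)]
  refine measure_mono fun g hg hg0 => ?_
  have hlt : |√(n : ℝ) * (g i - Y i)| < w.w (level i) := hg
  rw [hg0, zero_sub, mul_neg, abs_neg, abs_mul, abs_of_nonneg (Real.sqrt_nonneg _)] at hlt
  -- A zero coordinate gives `|x_i| = √n |Y_i| ≥ w_l`, outside the support of the bump.
  exact absurd (hM.trans (le_sqrt_mul_abs_of_typical hn hf hY)) (not_le.2 hlt)

end

/-! ### Limits along the sample sizes and conclusion -/

theorem tendsto_ofReal_const_mul_rpow_neg (c : ℝ) {s : ℝ} (hs : 0 < s) :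
    Tendsto (fun n : ℕ => ENNReal.ofReal (c * (n : ℝ) ^ (-s))) atTop (𝓝 0) := by
  have := ((tendsto_rpow_neg_atTop hs).comp (tendsto_natCast_atTop_atTop (R := ℝ))).const_mul c
  rw [mul_zero] at this
  simpa using ENNReal.tendsto_ofReal this

theorem tendsto_sub_mul_one_sub {a : ℝ≥0∞} {u v : ℕ → ℝ≥0∞} (hu : Tendsto u atTop (𝓝 0))
    (hv : Tendsto v atTop (𝓝 0)) (ha : a ≠ ∞) :
    Tendsto (fun m => (a - u m) * (1 - v m)) atTop (𝓝 a) := by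
  have h1 := ENNReal.Tendsto.sub (tendsto_const_nhds (x := a) (f := (atTop : Filter ℕ))) hu (Or.inl ha)
  have h2 := ENNReal.Tendsto.sub (tendsto_const_nhds (x := (1 : ℝ≥0∞)) (f := (atTop : Filter ℕ))) hv
    (Or.inl ENNReal.one_ne_top)
  rw [tsub_zero] at h1 h2
  simpa using ENNReal.Tendsto.mul h1 (Or.inr ENNReal.one_ne_top) h2 (Or.inr ha)

theorem expectedOutside_le_one {J0 n : ℕ} (P : SlabSpike (fun _ => 0))
    (hJ : J0 + 1 ≤ Nat.log 2 n) (w : Weight) (M : ℝ) (f : Idx J0 → ℝ) :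
    expectedOutside w (P.prior J0 n) n M f ≤ 1 := by
  calc expectedOutside w (P.prior J0 n) n M f ≤ ∫⁻ _, 1 ∂dataLaw n f :=
        lintegral_mono fun Y => by
          have := P.isProbabilityMeasure_posterior hJ Y
          exact prob_le_one
    _ = 1 := by simp

theorem gaussianReal_real_abs_le_half_pos : 0 < (gaussianReal 0 1).real {y | |y| ≤ 1 / 2} := by
  refine ENNReal.toReal_pos (fun h => ?_) (measure_ne_top _ _)
  have h0 := gaussianReal_absolutelyContinuous' 0 one_ne_zero h
  have hsub : Set.Icc (0 : ℝ) (1 / 2) ⊆ {y | |y| ≤ 1 / 2} := fun y hy => by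
    rw [Set.mem_ofPred_eq, abs_of_nonneg hy.1]
    exact hy.2
  have := measure_mono_null hsub h0
  simp at this

/-- `N k` is the number of the last sample size not exceeding `k`. It serves as `Mbar`, which must
be indexed by `k` but controlled at `k = n_m`. -/
theorem exists_tendsto_atTop_comp_eq {n : ℕ → ℕ} (hn : StrictMono n) :
    ∃ N : ℕ → ℕ, Tendsto N atTop atTop ∧ ∀ m, N (n m) = m := by
  refine ⟨fun k => Nat.findGreatest (fun m => n m ≤ k) k, tendsto_atTop.2 fun b => ?_, fun m => ?_⟩
  · filter_upwards [eventually_ge_atTop (n b)] with k hk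
    exact Nat.le_findGreatest ((hn.id_le b).trans hk) hk
  · refine le_antisymm ?_ (Nat.le_findGreatest (hn.id_le m) le_rfl)
    exact hn.le_iff_le.1 (Nat.findGreatest_spec (P := fun k => n k ≤ n m) (hn.id_le m) le_rfl)

end SlabSpikeBvM

open SlabSpikeBvM in
theorem mainTheorem7 (B : WaveletBasis) (β R : ℝ) (hβ : 0 < β) (hR : 0 < R) :
    ∃ ε : ℝ, 0 < ε ∧ ∀ (w : Weight), w.Admissible →
      ∀ (P : SlabSpike (fun _ => 0)) (j₁ : ℕ), 0 < j₁ →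
        ∃ f₀ ∈ B.selfSimilar j₁ β R ε,
          (∃ n : ℕ → ℕ, StrictMono n ∧
            ∃ Mbar : ℕ → ℝ, Tendsto Mbar atTop atTop ∧
              ∀ M : ℕ → ℝ, Tendsto M atTop atTop → (∀ᶠ k in atTop, M k ≤ Mbar k) →
                Tendsto (fun m => expectedOutside w (P.prior B.J0 (n m)) (n m) (M (n m))
                  (B.coeff f₀)) atTop (𝓝 1)) ∧
          ¬ WeakBvM w (P.prior B.J0) (B.coeff f₀) := by
  obtain ⟨ε, hε, hf⟩ := B.exists_mem_selfSimilar hβ hR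
  refine ⟨ε, hε, fun w hw P j₁ _ => ?_⟩
  obtain ⟨C, hC⟩ := P.bdd_g
  -- The factor `m + 1` provides the diverging rate and is at least 1, as the failure of weak BvM
  -- requires. The choice involves `w` but not the prior.
  obtain ⟨n, hn, hnm⟩ := extraction_forall_of_eventually fun m =>
    eventually_sample_size (B.J0 + (m + 1))
      (show 0 < R * (2 : ℝ) ^ (-((B.J0 + (m + 1) : ℕ) : ℝ) * (β + 1 / 2)) by positivity)
      ((m + 1) * w.w (B.J0 + (m + 1)))
  obtain ⟨f, hfmem, hfb⟩ := hf (fun m => √(Real.log (n m) / n m) / 2) (fun m => by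
    rw [abs_of_nonneg (by positivity)]
    exact (hnm m).2.1) j₁
  have hpow : ∀ m, 1 < 2 ^ (B.J0 + (m + 1)) := fun m => Nat.one_lt_two_pow (by omega)
  let i : ℕ → Idx B.J0 := fun m => Sum.inr ⟨m + 1, ⟨1, hpow m⟩⟩
  have hi : ∀ m, 0 < level (i m) := fun m => by simp only [i, level]; omega
  have hin : ∀ m, level (i m) ≤ Nat.log 2 (n m) := fun m => (hnm m).1
  have hJ : ∀ m, B.J0 + 1 ≤ Nat.log 2 (n m) := fun m => le_trans (by omega) (hnm m).1
  have hfi : ∀ m, B.coeff f (i m) = √(Real.log (n m) / n m) / 2 := fun m => hfb m (hpow m)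
  have hw1 : ∀ m, (m + 1) * w.w (level (i m)) ≤ √(Real.log (n m)) / 4 := fun m => (hnm m).2.2
  have hη := (tendsto_ofReal_const_mul_rpow_neg (C * √(2 * Real.pi))
    (show (0 : ℝ) < 7 / 32 by norm_num)).comp hn.tendsto_atTop
  have hρ := (tendsto_ofReal_const_mul_rpow_neg 2
    (show (0 : ℝ) < 1 / 32 by norm_num)).comp hn.tendsto_atTop
  refine ⟨f, hfmem, ⟨n, hn, ?_⟩, fun hBvM => ?_⟩
  · obtain ⟨N, hN, hNn⟩ := exists_tendsto_atTop_comp_eq hn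
    refine ⟨fun k => N k, tendsto_natCast_atTop_atTop.comp hN, fun M _ hM => ?_⟩
    refine tendsto_of_tendsto_of_tendsto_of_le_of_le'
      (tendsto_sub_mul_one_sub hη hρ ENNReal.one_ne_top) tendsto_const_nhds ?_
      (Eventually.of_forall fun m => expectedOutside_le_one P (hJ m) w _ _)
    filter_upwards [hn.tendsto_atTop.eventually hM] with m hm
    refine le_expectedOutside P hC (hJ m) (hi m) (hin m) (hfi m) w (le_trans ?_ (hw1 m))
    -- Now `M (n m) ≤ m`, within the margin `m + 1` built into `n`.
    rw [hNn] at hm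
    exact mul_le_mul_of_nonneg_right (by linarith) (w.pos _).le
  -- Weak BvM would send the distance to 0 along `n m` too, while its lower bound tends to the
  -- positive constant coming from the bump.
  · have hle := le_of_tendsto_of_tendsto' (tendsto_sub_mul_one_sub hη hρ
      (ENNReal.ofReal_ne_top (r := (gaussianReal 0 1).real {y | |y| ≤ 1 / 2} / 4)))
      (hBvM.comp hn.tendsto_atTop) fun m => le_lintegral_blDist P hC (hJ m) (hi m) (hin m) (hfi m) w
        hw (le_trans (le_mul_of_one_le_left (w.pos _).le (by
          have := Nat.cast_nonneg (α := ℝ) m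
          linarith)) (hw1 m))
    have := gaussianReal_real_abs_le_half_pos
    exact absurd hle (not_le.2 (ENNReal.ofReal_pos.2 (by positivity)))
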